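/- Let $A=\bigoplus_{\nu\ge 0}A_\nu$ be a graded integral domain of finite type over $\mathbb C$, and let $V=\operatorname{Spec}A$ be the corresponding affine variety with its $\mathbb C^*$-action ($t\in\mathbb C^*$ acts on $A_\nu$ as multiplication by $t^\nu$). Suppose that the vertex set $V(A_+)$, where $A_+=\bigoplus_{\nu>0}A_\nu$, consists of a single point $p$, that $V$ is normal at $p$, and that all points $q\neq p$ of some neighbourhood of $p$ are regular points of $V$. By a rational curve we mean a (reduced irreducible) curve whose function field is $\mathbb C$-isomorphic to $\mathbb C(t)$. By an orbit closure we mean the closure in $V$ of a one-dimensional orbit of the $\mathbb C^*$-action. "For a general point" means for every closed point of some nonempty Zariski open dense subset. The singularity $(V,p)$ is called quasirational if $\Gamma=(V\setminus\{p\})/\mathbb C^*=\operatorname{Proj}A$ is uniruled, i.e. if for a general point $x\in\Gamma$ there is a rational curve $C\subseteq\Gamma$ passing through $x$. Then the following conditions are equivalent: (i) $(V,p)$ is a quasirational singularity; (ii) for a general point $x\in V$ there exists a closed rational curve $C\subseteq V$ which passes through $x$ and is different from an orbit closure. If $\dim V=2$, these are also equivalent to: (iii) the surface $V$ is rational, i.e.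 birational over $\mathbb C$ to an affine space. -/

import Mathlib

open AlgebraicGeometry CategoryTheory

noncomputable section

namespace Quasihomogeneous

/-- An integral closed subscheme `ι : C ⟶ X` of a `ℂ`-scheme `f : X ⟶ Spec ℂ` is a closed rational
curve if the function field of `C` is isomorphic, over `ℂ`, to the field `ℂ(t)`. -/
def IsClosedRationalCurve {X : Scheme.{0}} (f : X ⟶ Spec (.of ℂ)) {C : Scheme.{0}} (ι : C ⟶ X) :
    Prop :=
  IsClosedImmersion ι ∧ ∃ _ : IsIntegral C,
    ∃ e : Spec (.of (RatFunc ℂ)) ≅ Spec C.functionField,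
      e.hom ≫ C.fromSpecStalk (genericPoint C) ≫ ι ≫ f =
        Spec.map (CommRingCat.ofHom (algebraMap ℂ (RatFunc ℂ)))

/-- `P x` holds for a general (closed) point `x` of `X`: there is a nonempty, dense, Zariski open
subset of `X` at each of whose closed points `P` holds. -/
def ForGeneralPoint (X : Scheme.{0}) (P : X → Prop) : Prop :=
  ∃ U : X.Opens, (U : Set X).Nonempty ∧ Dense (U : Set X) ∧ ∀ x ∈ U, IsClosed {x} → P x

/-- A complex variety `X` is uniruled if through a general point of `X` there passes a rational
curve `C ⊆ X`. -/
def IsUniruled {X : Scheme.{0}} (f : X ⟶ Spec (.of ℂ)) : Prop :=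
  ForGeneralPoint X fun x =>
    ∃ (C : Scheme.{0}) (ι : C ⟶ X), IsClosedRationalCurve f ι ∧ x ∈ Set.range ι

section Graded

variable {A : Type} [CommRing A] [Algebra ℂ A] (𝒜 : ℕ → Submodule ℂ A) [GradedAlgebra 𝒜]

/-- The structure morphism `V = Spec A ⟶ Spec ℂ`. -/
def structureV (A : Type) [CommRing A] [Algebra ℂ A] :
    Spec (CommRingCat.of A) ⟶ Spec (CommRingCat.of ℂ) :=
  Spec.map (CommRingCat.ofHom (algebraMap ℂ A))

/-- The structure morphism `Γ = Proj A ⟶ Spec A₀ ⟶ Spec ℂ`. -/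
def structureΓ : Proj 𝒜 ⟶ Spec (CommRingCat.of ℂ) :=
  Proj.toSpecZero 𝒜 ≫ Spec.map (CommRingCat.ofHom (algebraMap ℂ (𝒜 0)))

/-- The singularity of `Spec A` at its vertex is quasirational if `Γ = Proj A` is uniruled. -/
def IsQuasirational : Prop := IsUniruled (structureΓ 𝒜)

/-- The action of `t ∈ ℂ*` on the coordinate ring `A`, given by `a ↦ t ^ ν • a` on `A_ν`. -/
def act (t : ℂˣ) : A →ₐ[ℂ] A :=
  (DirectSum.toAlgebra ℂ (fun ν => 𝒜 ν) (fun ν => ((t : ℂ) ^ ν) • (𝒜 ν).subtype)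
    (by simp) (by
      intro i j a b
      simp [pow_add, smul_smul, mul_comm])).comp
    (DirectSum.decomposeAlgEquiv 𝒜).toAlgHom

theorem act_of_mem (t : ℂˣ) {ν : ℕ} {a : A} (ha : a ∈ 𝒜 ν) : act 𝒜 t a = (t : ℂ) ^ ν • a := by
  simp only [act, AlgHom.comp_apply]
  erw [DirectSum.decomposeAlgEquiv_apply, DirectSum.decompose_of_mem 𝒜 ha]
  erw [DirectSum.toAlgebra_apply, DirectSum.toSemiring_of]
  simp

/-- The `ℂ*`-orbit of a point `x` of `V = Spec A`. -/
def orbit (x : PrimeSpectrum A) : Set (PrimeSpectrum A) :=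
  Set.range fun t : ℂˣ => PrimeSpectrum.comap (act 𝒜 t).toRingHom x

/-- An orbit closure is the closure in `V` of a one-dimensional orbit of a closed point. As `ℂ*` is
connected and one-dimensional, an orbit is one-dimensional iff it is not a single point. -/
def IsOrbitClosure (Z : Set (PrimeSpectrum A)) : Prop :=
  ∃ x : PrimeSpectrum A, IsClosed {x} ∧ (orbit 𝒜 x).Nontrivial ∧ Z = closure (orbit 𝒜 x)

/-- Through a general point of `V = Spec A` there passes a closed rational curve `C ⊆ V` which is
different from an orbit closure. -/
def HasGeneralRationalCurves : Prop :=
  ForGeneralPoint (Spec (CommRingCat.of A)) fun x =>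
    ∃ (C : Scheme.{0}) (ι : C ⟶ Spec (CommRingCat.of A)),
      IsClosedRationalCurve (structureV A) ι ∧ x ∈ Set.range ι ∧ ¬ IsOrbitClosure 𝒜 (Set.range ι)

end Graded

/-- `p` is an isolated normal singularity of `Spec A`: the local ring at `p` is a normal domain, and
the local rings at all other points of a neighbourhood of `p` are regular. (A regular point `p` is
allowed.) -/
def IsIsolatedNormalSingularity {A : Type} [CommRing A] (p : PrimeSpectrum A) : Prop :=
  IsDomain (Localization.AtPrime p.asIdeal) ∧
  IsIntegrallyClosed (Localization.AtPrime p.asIdeal) ∧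
    ∃ U : Set (PrimeSpectrum A), IsOpen U ∧ p ∈ U ∧
      ∀ q ∈ U, q ≠ p → IsRegularLocalRing (Localization.AtPrime q.asIdeal)

end Quasihomogeneous

end

/-!
The set `V(A_+)` is a single point iff the irrelevant ideal `A_+` is maximal, and then `A₀ = ℂ`.
Both conditions are translated into statements about homomorphisms to the field `ℂ(t)`. The generic
point of a rational curve in an affine variety `Spec R` is the kernel of a homomorphism
`R →ₐ[ℂ] ℂ(t)` whose image has fraction field `ℂ(t)`, and conversely every such kernel is the
generic point of a closed rational curve (`IsRationalPoint.exists_isClosedRationalCurve`,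
`isRationalPoint_spec_iff`). On a chart `D₊(h)` of `Proj A` the same holds with the ring `Away 𝒜 h`
of fractions of degree zero (`isRationalPoint_proj_iff`). The curve passes through a point exactly
when the kernel is contained in the ideal of the point.

From (ii) to (i): a rational curve in `Spec A` through a general point is given by
`φ : A →ₐ[ℂ] ℂ(t)`, and it induces a homomorphism on fractions of degree zero. If all values of the
latter are constant, then `A` modulo the homogeneous core of `ker φ` is integral over a polynomial
ring in one variable, so that the curve is an orbit closure (`isOrbitClosure_of_forall_eq`).
Otherwise the fractions of its image form, by Lüroth's theorem, a field isomorphic to `ℂ(t)`, and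
this gives a rational curve in `Proj A` (`isRationalPoint_of_algHom`).

From (i) to (ii): let `d` generate the group of degrees of homogeneous fractions, and let `f / g` be
a fraction of degree `d`. Then `A` embeds into the polynomial ring in `T = f / g` over a ring of
fractions of degree zero (`dehomogenize`). Substituting for `T` its value at a given closed point
`x` turns a rational curve in `Proj A` through the image of `x` into a rational curve in `Spec A`
through `x`. On this curve `f / g` is constant, which is impossible on an orbit closure, because the
ideal of an orbit closure is homogeneous (`exists_rational_section`).

Now let `dim A = 2`. A homomorphism on fractions of degree zero which is not constant has kernel
zero, because a nonzero kernel would lead to a chain of four primes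
(`eq_bot_of_ringKrullDim_eq_two`); thus `Proj A` is itself the rational curve in question. If
`Proj A` is uniruled, this shows that the fractions of degree zero embed into `ℂ(t)` as a ring with
field of fractions `ℂ(t)`, so that dehomogenization identifies the function field of `Spec A` with
`ℂ(t)(T)` (`IsQuasirational.isRationalOver`). If `Spec A` is rational, then `A` embeds into a field
of rational functions in several variables, and the restriction of these functions to a suitable
line is a homomorphism `A →ₐ[ℂ] ℂ(t)` which is not constant on fractions of degree zero
(`exists_restriction_to_line`).
-/

noncomputable section

namespace Quasihomogeneous

open HomogeneousLocalization

/-! ### Rational curves and their generic points -/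

section

/-- The point `x` of a `ℂ`-scheme is the generic point of a rational curve: it is the image of a
preimmersion `Spec ℂ(t) ⟶ X` over `ℂ`. As the source is a point, being a preimmersion means that the
residue field of `x` is mapped isomorphically onto `ℂ(t)`. -/
def IsRationalPoint {X : Scheme.{0}} (f : X ⟶ Spec (.of ℂ)) (x : X) : Prop :=
  ∃ φ : Spec (.of (RatFunc ℂ)) ⟶ X, IsPreimmersion φ ∧
    φ ≫ f = Spec.map (CommRingCat.ofHom (algebraMap ℂ (RatFunc ℂ))) ∧ ∃ z, φ z = x

theorem IsClosedRationalCurve.exists_isRationalPoint {X : Scheme.{0}} {f : X ⟶ Spec (.of ℂ)}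
    {C : Scheme.{0}} {ι : C ⟶ X} (h : IsClosedRationalCurve f ι) :
    ∃ x, IsRationalPoint f x ∧ Set.range ι = closure {x} := by
  obtain ⟨h1, hC, e, he⟩ := h
  refine ⟨ι (genericPoint C), ⟨e.hom ≫ C.fromSpecStalk (genericPoint C) ≫ ι, inferInstance,
    by simpa using he, e.inv (IsLocalRing.closedPoint C.functionField), ?_⟩, ?_⟩
  · refine Eq.trans (Scheme.Hom.comp_apply e.inv _ _).symm ?_
    rw [Iso.inv_hom_id_assoc]
    exact congrArg ι Scheme.fromSpecStalk_closedPoint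
  have h2 := (genericPoint_spec C).image ι.continuous
  rw [IsGenericPoint, Set.image_univ, ι.isClosedEmbedding.isClosed_range.closure_eq] at h2
  exact h2.symm

/-- The map from the stalk to the field is injective, because the stalk is a field, and surjective,
because a preimmersion is surjective on stalks. -/
theorem exists_iso_stalk_of_isPreimmersion {K : Type} [Field K] {X : Scheme.{0}}
    (φ : Spec (.of K) ⟶ X) [IsPreimmersion φ] (x : X) (hx : φ (IsLocalRing.closedPoint K) = x)
    (hf : IsField (X.presheaf.stalk x)) :
    ∃ e : Spec (.of K) ≅ Spec (X.presheaf.stalk x), e.hom ≫ X.fromSpecStalk x = φ := by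
  subst hx
  have hb : Function.Bijective (Scheme.stalkClosedPointTo φ).hom := by
    constructor
    · let := hf.toField
      exact RingHom.injective _
    · have h1 := φ.stalkMap_surjective (IsLocalRing.closedPoint K)
      intro y
      obtain ⟨y', hy'⟩ := (stalkClosedPointIso (.of K)).commRingCatIsoToRingEquiv.surjective y
      obtain ⟨y'', hy''⟩ := h1 y'
      refine ⟨y'', ?_⟩
      rw [← hy', ← hy'']
      rfl
  have : IsIso (Scheme.stalkClosedPointTo φ) := by
    rw [ConcreteCategory.isIso_iff_bijective]
    exact hb
  exact ⟨asIso (Spec.map (Scheme.stalkClosedPointTo φ)),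
    Scheme.Spec_stalkClosedPointTo_fromSpecStalk φ⟩

instance {K : Type} [Field K] {X : Scheme.{0}} (φ : Spec (.of K) ⟶ X) : IsIntegral φ.image := by
  have (x : φ.image) : _root_.IsReduced (φ.image.presheaf.stalk x) := by
    obtain ⟨_, ⟨U, hU, rfl⟩, hxU, -⟩ := X.isBasis_affineOpens.exists_subset_of_mem_open
      (Set.mem_univ (φ.imageι x)) isOpen_univ
    have hV : IsAffineOpen (φ.imageι ⁻¹ᵁ U) := hU.preimage φ.imageι
    have h1 : _root_.IsReduced Γ(φ.image, φ.imageι ⁻¹ᵁ U) :=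
      isReduced_of_injective _ (φ.toImage_app_injective ⟨U, hU⟩)
    let x' : (φ.imageι ⁻¹ᵁ U : φ.image.Opens) := ⟨x, hxU⟩
    let := φ.image.presheaf.algebra_section_stalk x'
    have := hV.isLocalization_stalk x'
    exact isReduced_localizationPreserves (hV.primeIdealOf x').asIdeal.primeCompl
      (φ.image.presheaf.stalk x'.1) h1
  have : IsReduced φ.image := isReduced_of_isReduced_stalk _
  have hs : IsPreirreducible (Set.univ : Set φ.image) := by
    rw [← φ.toImage.denseRange.closure_range]
    refine IsPreirreducible.closure ?_
    have : Subsingleton (PrimeSpectrum K) := inferInstance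
    have : (Set.range φ.toImage).Subsingleton := by
      rintro _ ⟨a, rfl⟩ _ ⟨b, rfl⟩
      rw [Subsingleton.elim (α := PrimeSpectrum K) a b]
    exact this.isPreirreducible
  have : PreirreducibleSpace φ.image := ⟨hs⟩
  have : Nonempty φ.image := ⟨φ.toImage (IsLocalRing.closedPoint K)⟩
  have : IrreducibleSpace φ.image := ⟨inferInstance⟩
  exact isIntegral_of_irreducibleSpace_of_isReduced _

/-- The curve is the scheme-theoretic image of `Spec ℂ(t)`, that is, the closure of `x` with its
reduced structure. -/
theorem IsRationalPoint.exists_isClosedRationalCurve {X : Scheme.{0}} {f : X ⟶ Spec (.of ℂ)}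
    {x : X} (h : IsRationalPoint f x) :
    ∃ (C : Scheme.{0}) (ι : C ⟶ X), IsClosedRationalCurve f ι ∧ Set.range ι = closure {x} := by
  obtain ⟨φ, h1, h2, z, rfl⟩ := h
  have : IsPreimmersion (φ.toImage ≫ φ.imageι) := by simpa
  have : IsPreimmersion φ.toImage := IsPreimmersion.of_comp φ.toImage φ.imageι
  have hz : ∀ w, w = z := fun w ↦ Subsingleton.elim (α := PrimeSpectrum (RatFunc ℂ)) _ _
  have hr : Set.range φ.toImage = {φ.toImage z} := by
    ext w
    constructor
    · rintro ⟨w, rfl⟩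
      rw [hz w]; rfl
    · rintro rfl
      exact ⟨z, rfl⟩
  have hg : φ.toImage z = genericPoint φ.image := by
    refine IsGenericPoint.eq (S := Set.univ) ?_ (genericPoint_spec _)
    rw [IsGenericPoint, ← hr]
    exact φ.toImage.denseRange.closure_range
  have hc : Set.range φ.imageι = closure {φ z} := by
    have h3 : IsGenericPoint (φ.toImage z) Set.univ := by
      rw [hg]; exact genericPoint_spec _
    have h2 := h3.image φ.imageι.continuous
    rw [IsGenericPoint, Set.image_univ, φ.imageι.isClosedEmbedding.isClosed_range.closure_eq] at h2
    rw [← h2, ← Scheme.Hom.comp_apply, Scheme.Hom.toImage_imageι]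
  obtain ⟨e, he⟩ := exists_iso_stalk_of_isPreimmersion φ.toImage (genericPoint φ.image)
    (by rw [← hg]; congr 1; exact hz _) (Field.toIsField φ.image.functionField)
  refine ⟨φ.image, φ.imageι, ⟨inferInstance, inferInstance, e, ?_⟩, hc⟩
  rw [reassoc_of% he, Scheme.Hom.toImage_imageι_assoc, h2]

/-- For a field `K`, the map `Spec K ⟶ Spec R` is a preimmersion iff `K` is the field of fractions
of the image of `R`. -/
theorem isPreimmersion_SpecMap_iff {R K : Type} [CommRing R] [Field K] (ψ : R →+* K) :
    IsPreimmersion (Spec.map (CommRingCat.ofHom ψ)) ↔ ∀ r : K, ∃ a b, ψ b ≠ 0 ∧ r * ψ b = ψ a := by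
  rw [IsPreimmersion.SpecMap_iff]
  constructor
  · rintro ⟨-, h⟩ r
    have := h ⊥ inferInstance
    obtain ⟨y, hy⟩ := this (algebraMap K _ r)
    obtain ⟨a, s, rfl⟩ := IsLocalization.exists_mk'_eq (Ideal.comap ψ ⊥).primeCompl y
    refine ⟨a, s, ?_, ?_⟩
    · exact s.2
    · erw [Localization.localRingHom_mk'] at hy
      rw [IsLocalization.mk'_eq_iff_eq_mul, ← map_mul] at hy
      exact (FaithfulSMul.algebraMap_injective K (Localization.AtPrime (⊥ : Ideal K)) hy).symm
  · intro h
    refine ⟨?_, RingHom.surjectiveOnStalks_of_exists_div fun r ↦ ?_⟩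
    · exact Topology.IsEmbedding.of_subsingleton _
    · obtain ⟨a, b, hb, h⟩ := h r
      exact ⟨a, b, hb.isUnit, (mul_comm _ _).trans h⟩

/-- Being the generic point of a rational curve can be tested on an affine chart, where it amounts
to a homomorphism of the coordinate ring onto a subring of `ℂ(t)` with field of fractions `ℂ(t)`. -/
theorem isRationalPoint_iff_of_isOpenImmersion {X : Scheme.{0}} {f : X ⟶ Spec (.of ℂ)}
    {R : Type} [CommRing R] (j : Spec (.of R) ⟶ X) [IsOpenImmersion j]
    (g : ℂ →+* R) (hj : j ≫ f = Spec.map (CommRingCat.ofHom g)) (q : PrimeSpectrum R) :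
    IsRationalPoint f (j q) ↔ ∃ ψ : R →+* RatFunc ℂ, RingHom.ker ψ = q.asIdeal ∧
      ψ.comp g = algebraMap ℂ (RatFunc ℂ) ∧ ∀ r : RatFunc ℂ, ∃ a b, ψ b ≠ 0 ∧ r * ψ b = ψ a := by
  have hz : ∀ w z : (Spec (.of (RatFunc ℂ)) : Scheme.{0}), w = z :=
    fun w ↦ Subsingleton.elim (α := PrimeSpectrum (RatFunc ℂ)) _
  constructor
  · rintro ⟨φ, h1, h2, z, h3⟩
    have hr : Set.range φ ⊆ Set.range j := by
      rintro _ ⟨w, rfl⟩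
      rw [hz w z, h3]
      exact ⟨q, rfl⟩
    obtain ⟨ψ, hψ⟩ := Spec.map_surjective (IsOpenImmersion.lift j φ hr)
    have hφ : Spec.map ψ ≫ j = φ := by rw [hψ, IsOpenImmersion.lift_fac]
    subst hφ
    refine ⟨ψ.hom, ?_, ?_, ?_⟩
    · have : (Spec.map ψ) z = q := j.isOpenEmbedding.injective (by rw [← h3]; rfl)
      rw [← this, hz z (⊥ : PrimeSpectrum (RatFunc ℂ))]
      rfl
    · rw [Category.assoc, hj, ← Spec.map_comp] at h2
      exact congrArg CommRingCat.Hom.hom (Spec.map_injective h2)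
    · have := IsPreimmersion.of_comp (Spec.map ψ) j
      exact (isPreimmersion_SpecMap_iff ψ.hom).1 this
  · rintro ⟨ψ, h1, h2, h3⟩
    have := (isPreimmersion_SpecMap_iff ψ).2 h3
    refine ⟨Spec.map (CommRingCat.ofHom ψ) ≫ j, inferInstance, ?_,
      (⊥ : PrimeSpectrum (RatFunc ℂ)), ?_⟩
    · rw [Category.assoc, hj, ← Spec.map_comp, ← CommRingCat.ofHom_comp, h2]
    · exact congrArg j (PrimeSpectrum.ext h1 : PrimeSpectrum.comap ψ ⊥ = q)

end

/-! ### Generic points of rational curves in `Spec A` and `Proj A` -/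

section

variable {A : Type} [CommRing A] [Algebra ℂ A] (𝒜 : ℕ → Submodule ℂ A) [GradedAlgebra 𝒜]

theorem isRationalPoint_spec_iff (Q : PrimeSpectrum A) :
    IsRationalPoint (structureV A) (Q : Spec (.of A)) ↔
      ∃ ψ : A →ₐ[ℂ] RatFunc ℂ, RingHom.ker ψ = Q.asIdeal ∧
        ∀ r, ∃ a b, ψ b ≠ 0 ∧ r * ψ b = ψ a := by
  have key := isRationalPoint_iff_of_isOpenImmersion (f := structureV A) (𝟙 (Spec (.of A)))
    (algebraMap ℂ A) (by rw [Category.id_comp]; rfl) Q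
  refine key.trans ⟨?_, ?_⟩
  · rintro ⟨ψ, h1, h2, h3⟩
    exact ⟨⟨ψ, fun c ↦ RingHom.congr_fun h2 c⟩, h1, h3⟩
  · rintro ⟨ψ, h1, h3⟩
    exact ⟨ψ, h1, ψ.comp_algebraMap, h3⟩

/-- The homomorphism from the constants to the ring of fractions `a / h ^ k` of degree zero. -/
def awayConst (h : A) : ℂ →+* Away 𝒜 h :=
  (fromZeroRingHom 𝒜 (Submonoid.powers h)).comp (algebraMap ℂ (𝒜 0))

theorem val_awayConst (h : A) (c : ℂ) :
    (awayConst 𝒜 h c).val = algebraMap A (Localization.Away h) (algebraMap ℂ A c) := by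
  have := IsScalarTower.algebraMap_apply (𝒜 0) (Away 𝒜 h) (Localization.Away h)
    (algebraMap ℂ (𝒜 0) c)
  exact this.symm

variable {𝒜} {h : A} {m : ℕ} (hh : h ∈ 𝒜 m) (hm : 0 < m)

theorem isLocalizationElem_mul_self {n : ℕ} {g : A} (hg : g ∈ 𝒜 n) :
    Away.isLocalizationElem hh (SetLike.mul_mem_graded hg hh) =
      Away.isLocalizationElem hh hg := by
  apply val_injective
  rw [Away.val_mk, Away.val_mk, Localization.mk_eq_mk_iff, Localization.r_iff_exists]
  exact ⟨1, by simp; ring⟩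

theorem isLocalizationElem_eq_pow {k : ℕ} {g : A} (hg : g ∈ 𝒜 (k • m)) :
    Away.isLocalizationElem hh hg = Away.mk 𝒜 hh k g hg ^ m := by
  apply val_injective
  rw [val_pow, Away.val_mk, Away.val_mk, Localization.mk_pow, Localization.mk_eq_mk_iff,
    Localization.r_iff_exists]
  refine ⟨1, ?_⟩
  simp [← pow_mul]

include hm in
/-- The point of `Proj A` given by a prime `q` of the degree zero part of `A_h`: a homogeneous `g`
of degree `n` vanishes there iff `g ^ m / h ^ n` lies in `q`. -/
theorem mem_awayι_iff (q : PrimeSpectrum (Away 𝒜 h)) {n : ℕ} {g : A} (hg : g ∈ 𝒜 n) :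
    g ∈ (Proj.awayι 𝒜 h hh hm q).asHomogeneousIdeal ↔
      Away.isLocalizationElem hh hg ∈ q.asIdeal := by
  have key {n : ℕ} {g : A} (hn : 0 < n) (hg : g ∈ 𝒜 n) :
      g ∈ (Proj.awayι 𝒜 h hh hm q).asHomogeneousIdeal ↔
      Away.isLocalizationElem hh hg ∈ q.asIdeal := by
    have := congrArg (fun U : (Spec (.of (Away 𝒜 h))).Opens ↦ (q : Spec (.of (Away 𝒜 h))) ∈ U)
      (Proj.awayι_preimage_basicOpen 𝒜 hh hm hg hn)
    exact not_iff_not.1 (iff_of_eq this)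
  have hmem : h ∉ (Proj.awayι 𝒜 h hh hm q).asHomogeneousIdeal := by
    have : Proj.awayι 𝒜 h hh hm q ∈ (Proj.awayι 𝒜 h hh hm).opensRange := ⟨q, rfl⟩
    rwa [Proj.opensRange_awayι] at this
  rw [← isLocalizationElem_mul_self hh hg, ← key (by omega) (SetLike.mul_mem_graded hg hh)]
  constructor
  · intro h'
    exact Ideal.mul_mem_right h _ h'
  · intro h'
    exact ((Proj.awayι 𝒜 h hh hm q).isPrime.mem_or_mem h').resolve_right hmem

include hm in
theorem isRationalPoint_proj_iff (P : Proj 𝒜) (hP : h ∉ P.asHomogeneousIdeal) :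
    IsRationalPoint (structureΓ 𝒜) P ↔
      ∃ ψ : Away 𝒜 h →+* RatFunc ℂ, ψ.comp (awayConst 𝒜 h) = algebraMap ℂ (RatFunc ℂ) ∧
        (∀ (n : ℕ) (g : A) (hg : g ∈ 𝒜 n),
          ψ (Away.isLocalizationElem hh hg) = 0 ↔ g ∈ P.asHomogeneousIdeal) ∧
        ∀ r, ∃ a b, ψ b ≠ 0 ∧ r * ψ b = ψ a := by
  have hj : Proj.awayι 𝒜 h hh hm ≫ structureΓ 𝒜 = Spec.map (CommRingCat.ofHom (awayConst 𝒜 h)) := by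
    rw [structureΓ, Proj.awayι_toSpecZero_assoc, ← Spec.map_comp, ← CommRingCat.ofHom_comp]
    rfl
  constructor
  · intro h1
    have : P ∈ (Proj.awayι 𝒜 h hh hm).opensRange := by rwa [Proj.opensRange_awayι]
    obtain ⟨q, rfl⟩ := this
    obtain ⟨ψ, h2, h3, h4⟩ := (isRationalPoint_iff_of_isOpenImmersion _ _ hj q).1 h1
    refine ⟨ψ, h3, fun n g hg ↦ ?_, h4⟩
    rw [← RingHom.mem_ker, h2]
    exact (mem_awayι_iff hh hm q hg).symm
  · rintro ⟨ψ, h1, h2, h3⟩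
    let q : PrimeSpectrum (Away 𝒜 h) := ⟨RingHom.ker ψ, RingHom.ker_isPrime ψ⟩
    have : Proj.awayι 𝒜 h hh hm q = P := by
      refine ProjectiveSpectrum.ext (HomogeneousIdeal.ext' fun n g hg ↦ ?_)
      rw [← h2 n g hg]
      exact mem_awayι_iff hh hm q hg
    rw [← this]
    exact (isRationalPoint_iff_of_isOpenImmersion _ _ hj q).2 ⟨ψ, rfl, h1, h3⟩

end

/-! ### Homogeneous cores and orbit closures -/

section

variable {A : Type} [CommRing A] [Algebra ℂ A] (𝒜 : ℕ → Submodule ℂ A) [GradedAlgebra 𝒜]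

theorem mem_homogeneousCore_iff (I : Ideal A) (a : A) :
    a ∈ I.homogeneousCore 𝒜 ↔ ∀ n, (DirectSum.decompose 𝒜 a n : A) ∈ I := by
  have := Ideal.IsHomogeneous.mem_iff 𝒜 (I.homogeneousCore 𝒜).isHomogeneous (x := a)
  refine this.trans (forall_congr' fun n ↦
    ⟨fun h ↦ Ideal.toIdeal_homogeneousCore_le 𝒜 I h, fun h ↦ ?_⟩)
  exact Ideal.mem_homogeneousCore_of_homogeneous_of_mem ⟨n, SetLike.coe_mem _⟩ h

theorem mem_homogeneousCore_iff_of_mem (I : Ideal A) {a : A} {n : ℕ} (ha : a ∈ 𝒜 n) :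
    a ∈ I.homogeneousCore 𝒜 ↔ a ∈ I :=
  ⟨fun h ↦ Ideal.toIdeal_homogeneousCore_le 𝒜 I h,
    fun h ↦ Ideal.mem_homogeneousCore_of_homogeneous_of_mem ⟨n, ha⟩ h⟩

open scoped Classical in
theorem act_eq_sum (t : ℂˣ) (a : A) :
    act 𝒜 t a = ∑ n ∈ (DirectSum.decompose 𝒜 a).support,
      (t : ℂ) ^ n • (DirectSum.decompose 𝒜 a n : A) := by
  conv_lhs => rw [← DirectSum.sum_support_decompose 𝒜 a, map_sum]
  exact Finset.sum_congr rfl fun n _ ↦ act_of_mem 𝒜 t (SetLike.coe_mem _)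

/-- The translates `act t a` are the values at `t` of a polynomial whose coefficients are the
homogeneous components of `a`. Since `ℂ*` is infinite, they all lie in `I` only if the components
do. -/
theorem forall_act_mem_iff (I : Ideal A) [I.IsPrime] (a : A) :
    (∀ t : ℂˣ, act 𝒜 t a ∈ I) ↔ a ∈ I.homogeneousCore 𝒜 := by
  classical
  rw [mem_homogeneousCore_iff]
  constructor
  · intro H
    let f : Polynomial (A ⧸ I) := ∑ n ∈ (DirectSum.decompose 𝒜 a).support,
      Polynomial.monomial n (Ideal.Quotient.mk I (DirectSum.decompose 𝒜 a n : A))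
    have hf : f = 0 := by
      refine Polynomial.eq_zero_of_infinite_isRoot f ?_
      have hinj : Function.Injective (fun t : ℂˣ ↦ algebraMap ℂ (A ⧸ I) t) :=
        (algebraMap ℂ (A ⧸ I)).injective.comp Units.val_injective
      have : Infinite ℂˣ := Infinite.of_injective
        (fun n : ℕ ↦ Units.mk0 ((n : ℂ) + 1) (Nat.cast_add_one_ne_zero n)) fun a b h ↦ by
          simpa using congrArg Units.val h
      refine (Set.infinite_range_of_injective hinj).mono ?_
      rintro _ ⟨t, rfl⟩
      have := Ideal.Quotient.eq_zero_iff_mem.2 (H t)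
      rw [act_eq_sum, map_sum] at this
      simp only [f, Set.mem_ofPred_eq, Polynomial.IsRoot.def, Polynomial.eval_finsetSum,
        Polynomial.eval_monomial]
      rw [← this]
      refine Finset.sum_congr rfl fun n _ ↦ ?_
      rw [Algebra.smul_def, map_mul, mul_comm, map_pow, map_pow]
      rfl
    intro n
    have hn := congrArg (fun g ↦ Polynomial.coeff g n) hf
    simp only [f, Polynomial.finsetSum_coeff, Polynomial.coeff_monomial, Finset.sum_ite_eq',
      Polynomial.coeff_zero] at hn
    split_ifs at hn with h1
    · exact Ideal.Quotient.eq_zero_iff_mem.1 hn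
    · simp only [DFinsupp.mem_support_toFun, ne_eq, not_not] at h1
      rw [h1]; exact I.zero_mem
  · intro H t
    rw [act_eq_sum]
    refine I.sum_mem fun n _ ↦ ?_
    rw [Algebra.smul_def]
    exact I.mul_mem_left _ (H n)

theorem closure_orbit (x : PrimeSpectrum A) :
    closure (orbit 𝒜 x) = PrimeSpectrum.zeroLocus (x.asIdeal.homogeneousCore 𝒜 : Set A) := by
  rw [← PrimeSpectrum.zeroLocus_vanishingIdeal_eq_closure]
  congr 1
  ext a
  simp only [SetLike.mem_coe, PrimeSpectrum.mem_vanishingIdeal, orbit, Set.forall_mem_range]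
  exact forall_act_mem_iff 𝒜 x.asIdeal a

theorem asIdeal_eq_homogeneousCore_of_orbit_subsingleton (x : PrimeSpectrum A)
    (h : ¬ (orbit 𝒜 x).Nontrivial) : x.asIdeal = (x.asIdeal.homogeneousCore 𝒜).toIdeal := by
  refine le_antisymm (fun a ha ↦ ?_) (Ideal.toIdeal_homogeneousCore_le 𝒜 _)
  refine (forall_act_mem_iff 𝒜 x.asIdeal a).1 fun t ↦ ?_
  have h1 : PrimeSpectrum.comap (act 𝒜 1).toRingHom x = x := by
    have : (act 𝒜 1).toRingHom = RingHom.id A := by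
      ext a
      change act 𝒜 1 a = a
      classical
      rw [act_eq_sum]
      simpa using DirectSum.sum_support_decompose 𝒜 a
    rw [this]; rfl
  have h2 : PrimeSpectrum.comap (act 𝒜 t).toRingHom x = x :=
    (Set.not_nontrivial_iff.1 h ⟨t, rfl⟩ ⟨1, rfl⟩).trans h1
  rw [← h2] at ha
  exact ha

theorem IsOrbitClosure.isHomogeneous {Q : PrimeSpectrum A}
    (h : IsOrbitClosure 𝒜 (closure {Q})) : Q.asIdeal.IsHomogeneous 𝒜 := by
  obtain ⟨x, -, -, h⟩ := h
  rw [closure_orbit, PrimeSpectrum.closure_singleton] at h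
  have h' := congrArg PrimeSpectrum.vanishingIdeal h
  rw [PrimeSpectrum.vanishingIdeal_zeroLocus_eq_radical] at h'
  have h2 := PrimeSpectrum.vanishingIdeal_zeroLocus_eq_radical (x.asIdeal.homogeneousCore 𝒜).toIdeal
  have h3 : (x.asIdeal.homogeneousCore 𝒜).toIdeal.IsPrime := x.2.homogeneousCore
  rw [h3.isRadical.radical] at h2
  rw [Q.2.isRadical.radical] at h'
  rw [h']
  erw [h2]
  exact (x.asIdeal.homogeneousCore 𝒜).isHomogeneous

end

/-! ### Graded algebras with a single vertex, and homogeneous localization -/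

section

/-- Hilbert's Nullstellensatz: closed points are evaluations. -/
theorem exists_algHom_ker_eq {A : Type} [CommRing A] [Algebra ℂ A] [Algebra.FiniteType ℂ A]
    (x : Ideal A) [x.IsMaximal] : ∃ ev : A →ₐ[ℂ] ℂ, RingHom.ker ev = x := by
  let := Ideal.Quotient.field x
  have : Module.Finite ℂ (A ⧸ x) := finite_of_finite_type_of_isJacobsonRing ℂ (A ⧸ x)
  let e : ℂ ≃ₐ[ℂ] (A ⧸ x) := AlgEquiv.ofBijective (Algebra.ofId ℂ (A ⧸ x))
    (IsAlgClosed.algebraMap_bijective_of_isIntegral)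
  refine ⟨e.symm.toAlgHom.comp (Ideal.Quotient.mkₐ ℂ x), ?_⟩
  ext a
  rw [RingHom.mem_ker]
  change e.symm (Ideal.Quotient.mk x a) = 0 ↔ _
  rw [map_eq_zero_iff _ e.symm.injective, Ideal.Quotient.eq_zero_iff_mem]

theorem exists_isMaximal_ge_notMem {A : Type} [CommRing A] [Algebra ℂ A] [Algebra.FiniteType ℂ A]
    (P : Ideal A) [hP : P.IsPrime] {a : A} (ha : a ∉ P) :
    ∃ x : Ideal A, x.IsMaximal ∧ P ≤ x ∧ a ∉ x := by
  have : IsJacobsonRing A := isJacobsonRing_of_finiteType (A := ℂ)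
  have h := this.out hP.isRadical
  by_contra! H
  refine ha ?_
  rw [← h, Ideal.jacobson, Submodule.mem_sInf]
  exact fun x hx ↦ H x hx.2 hx.1

variable {A : Type} [CommRing A] [Algebra ℂ A] {𝒜 : ℕ → Submodule ℂ A} [GradedAlgebra 𝒜]

theorem isPrime_irrelevant [IsDomain A] : (HomogeneousIdeal.irrelevant 𝒜).toIdeal.IsPrime := by
  rw [HomogeneousIdeal.toIdeal_irrelevant]
  exact RingHom.ker_isPrime _

theorem isMaximal_irrelevant [IsDomain A] {p : PrimeSpectrum A}
    (hvertex : PrimeSpectrum.zeroLocus (HomogeneousIdeal.irrelevant 𝒜 : Set A) = {p}) :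
    (HomogeneousIdeal.irrelevant 𝒜).toIdeal.IsMaximal := by
  have key (q : PrimeSpectrum A) (hq : (HomogeneousIdeal.irrelevant 𝒜).toIdeal ≤ q.asIdeal) :
      q = p := by
    have : q ∈ PrimeSpectrum.zeroLocus (HomogeneousIdeal.irrelevant 𝒜 : Set A) := hq
    rwa [hvertex] at this
  have h1 := key ⟨_, isPrime_irrelevant⟩ le_rfl
  obtain ⟨M, hM, hM'⟩ := Ideal.exists_le_maximal _ (isPrime_irrelevant (𝒜 := 𝒜)).ne_top
  have h2 := (key ⟨M, hM.isPrime⟩ hM').trans h1.symm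
  have h3 : M = (HomogeneousIdeal.irrelevant 𝒜).toIdeal := congrArg PrimeSpectrum.asIdeal h2
  rwa [← h3]

theorem exists_algebraMap_eq_of_mem_zero [Algebra.FiniteType ℂ A]
    (hmax : (HomogeneousIdeal.irrelevant 𝒜).toIdeal.IsMaximal) {a : A} (ha : a ∈ 𝒜 0) :
    ∃ c : ℂ, a = algebraMap ℂ A c := by
  obtain ⟨ev, hev⟩ := exists_algHom_ker_eq (HomogeneousIdeal.irrelevant 𝒜).toIdeal
  refine ⟨ev a, ?_⟩
  have h1 : a - algebraMap ℂ A (ev a) ∈ HomogeneousIdeal.irrelevant 𝒜 := by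
    rw [← HomogeneousIdeal.mem_iff, ← hev, RingHom.mem_ker]
    simp
  have h2 : a - algebraMap ℂ A (ev a) ∈ 𝒜 0 := sub_mem ha (SetLike.algebraMap_mem_graded 𝒜 _)
  rw [HomogeneousIdeal.mem_irrelevant_iff, GradedRing.proj_apply,
    DirectSum.decompose_of_mem_same 𝒜 h2] at h1
  exact sub_eq_zero.1 h1

/-- If the irrelevant ideal is maximal, then it is the largest proper homogeneous ideal. -/
theorem le_irrelevant [Algebra.FiniteType ℂ A]
    (hmax : (HomogeneousIdeal.irrelevant 𝒜).toIdeal.IsMaximal) (I : HomogeneousIdeal 𝒜)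
    (hI : I.toIdeal ≠ ⊤) : I ≤ HomogeneousIdeal.irrelevant 𝒜 := by
  intro a ha
  rw [HomogeneousIdeal.mem_irrelevant_iff, GradedRing.proj_apply]
  have h1 := (I.isHomogeneous.mem_iff).1 ha 0
  obtain ⟨c, hc⟩ := exists_algebraMap_eq_of_mem_zero hmax
    (SetLike.coe_mem (DirectSum.decompose 𝒜 a 0))
  rw [hc] at h1 ⊢
  by_contra h0
  refine hI (Ideal.eq_top_of_isUnit_mem _ h1 ((IsUnit.mk0 c ?_).map (algebraMap ℂ A)))
  rintro rfl
  exact h0 (map_zero _)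

theorem sub_algebraMap_mul_mem_homogeneousCore {x : Ideal A} {ev : A →ₐ[ℂ] ℂ}
    (hev : RingHom.ker ev = x) {a b : A} {n : ℕ} (ha : a ∈ 𝒜 n) (hb : b ∈ 𝒜 n) (hb0 : b ∉ x) :
    a - algebraMap ℂ A (ev a / ev b) * b ∈ x.homogeneousCore 𝒜 := by
  have hb1 : ev b ≠ 0 := by rwa [← hev, RingHom.mem_ker] at hb0
  refine (mem_homogeneousCore_iff_of_mem 𝒜 x (n := n) (sub_mem ha ?_)).2 ?_
  · rw [← Algebra.smul_def]
    exact Submodule.smul_mem _ _ hb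
  · rw [← hev, RingHom.mem_ker]
    simp [hb1]

/-- The homogeneous core of the ideal of a closed point gives a closed point of `Proj A`. -/
theorem asHomogeneousIdeal_eq_homogeneousCore_of_le {x : Ideal A} {ev : A →ₐ[ℂ] ℂ}
    (hev : RingHom.ker ev = x) {h : A} {m : ℕ} (hh : h ∈ 𝒜 m) (hm : 0 < m) (hx : h ∉ x)
    (z : ProjectiveSpectrum 𝒜)
    (hz : x.homogeneousCore 𝒜 ≤ z.asHomogeneousIdeal) :
    z.asHomogeneousIdeal = x.homogeneousCore 𝒜 := by
  refine HomogeneousIdeal.ext' fun n b hb ↦ ⟨fun hbz ↦ ?_, fun h ↦ hz h⟩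
  by_contra hbx
  rw [mem_homogeneousCore_iff_of_mem 𝒜 x hb] at hbx
  have hxp : x.IsPrime := hev ▸ RingHom.ker_isPrime _
  have hb1 : ev b ≠ 0 := by rwa [← hev, RingHom.mem_ker] at hbx
  have h1 := hz (sub_algebraMap_mul_mem_homogeneousCore (𝒜 := 𝒜) hev (SetLike.pow_mem_graded n hh)
    (a := h ^ n) (n := n • m) (b := b ^ m) (by
      rw [smul_eq_mul, mul_comm, ← smul_eq_mul]; exact SetLike.pow_mem_graded m hb)
    (fun h ↦ hbx (hxp.mem_of_pow_mem _ h)))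
  have hzp := z.isPrime
  have hhz : h ^ n ∈ z.asHomogeneousIdeal.toIdeal := by
    have h2 : algebraMap ℂ A (ev (h ^ n) / ev (b ^ m)) * b ^ m ∈ z.asHomogeneousIdeal.toIdeal :=
      Ideal.mul_mem_left _ _ (Ideal.pow_mem_of_mem _ hbz _ hm)
    simpa using add_mem h1 h2
  have hhz := hzp.mem_of_pow_mem _ hhz
  -- modulo the core of `x`, homogeneous elements of positive degree have powers proportional to
  -- powers of `h`
  refine z.not_irrelevant_le ((HomogeneousIdeal.irrelevant_le 𝒜).2 fun i hi a ha ↦ ?_)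
  have h1 := hz (sub_algebraMap_mul_mem_homogeneousCore (𝒜 := 𝒜) hev (SetLike.pow_mem_graded m ha)
    (b := h ^ i) (by
      rw [smul_eq_mul, mul_comm, ← smul_eq_mul]; exact SetLike.pow_mem_graded i hh)
    (fun h ↦ hx (hxp.mem_of_pow_mem _ h)))
  refine hzp.mem_of_pow_mem m ?_
  have h2 : algebraMap ℂ A (ev (a ^ m) / ev (h ^ i)) * h ^ i ∈ z.asHomogeneousIdeal.toIdeal :=
      Ideal.mul_mem_left _ _ (Ideal.pow_mem_of_mem _ hhz _ hi)
  simpa using add_mem h1 h2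

/-- Under the hypothesis, the powers `a ^ m` of homogeneous elements become multiples of powers of
`h` modulo `P`. Hence `A ⧸ P` is integral over `ℂ[h]`, so that it has dimension at most one. -/
theorem isMaximal_of_lt {P Q : Ideal A} [P.IsPrime] [Q.IsPrime] (hPQ : P < Q) {h : A} {m : ℕ}
    (hm : 0 < m)
    (H : ∀ n, ∀ a ∈ 𝒜 n, ∃ c : ℂ, a ^ m - algebraMap ℂ A c * h ^ n ∈ P) : Q.IsMaximal := by
  classical
  let := (Polynomial.aeval (R := ℂ) (Ideal.Quotient.mk P h)).toRingHom.toAlgebra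
  have halg (f : Polynomial ℂ) : algebraMap (Polynomial ℂ) (A ⧸ P) f =
    Polynomial.aeval (Ideal.Quotient.mk P h) f := rfl
  have hint : Algebra.IsIntegral (Polynomial ℂ) (A ⧸ P) := by
    refine ⟨fun b ↦ ?_⟩
    obtain ⟨a, rfl⟩ := Ideal.Quotient.mk_surjective b
    rw [← DirectSum.sum_support_decompose 𝒜 a, map_sum]
    refine IsIntegral.sum _ fun n _ ↦ IsIntegral.of_pow hm ?_
    obtain ⟨c, hc⟩ := H n _ (SetLike.coe_mem (DirectSum.decompose 𝒜 a n))
    have : Ideal.Quotient.mk P (DirectSum.decompose 𝒜 a n : A) ^ m =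
        algebraMap (Polynomial ℂ) (A ⧸ P) (Polynomial.C c * Polynomial.X ^ n) := by
      rw [halg, map_mul, Polynomial.aeval_C, map_pow, Polynomial.aeval_X, ← map_pow,
        ← sub_eq_zero, ← map_pow, ← Ideal.Quotient.eq_zero_iff_mem.2 hc, map_sub, map_mul]
      rfl
    rw [this]
    exact isIntegral_algebraMap
  let Q' := Q.map (Ideal.Quotient.mk P)
  have hQ' : Q'.comap (Ideal.Quotient.mk P) = Q := by
    rw [Ideal.comap_map_of_surjective _ Ideal.Quotient.mk_surjective, ← RingHom.ker_eq_comap_bot,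
      Ideal.mk_ker, sup_eq_left.2 hPQ.le]
  have hQp : Q'.IsPrime := Ideal.map_isPrime_of_surjective Ideal.Quotient.mk_surjective
    (by rw [Ideal.mk_ker]; exact hPQ.le)
  obtain ⟨r, hrQ, hrP⟩ := SetLike.exists_of_lt hPQ
  have hne : Q'.comap (algebraMap (Polynomial ℂ) (A ⧸ P)) ≠ ⊥ :=
    Ideal.comap_ne_bot_of_integral_mem (x := Ideal.Quotient.mk P r)
      (by rwa [Ne, Ideal.Quotient.eq_zero_iff_mem]) (Ideal.mem_map_of_mem _ hrQ)
      (hint.isIntegral _)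
  have hmax : (Q'.comap (algebraMap (Polynomial ℂ) (A ⧸ P))).IsMaximal :=
    IsPrime.to_maximal_ideal hne
  have := Ideal.isMaximal_of_isIntegral_of_isMaximal_comap Q' hmax
  rw [← hQ']
  exact Ideal.comap_isMaximal_of_surjective _ Ideal.Quotient.mk_surjective

variable {h : A} {m : ℕ} (hh : h ∈ 𝒜 m)

theorem isUnit_algebraMap_pow {A : Type} [CommRing A] (h : A) (k : ℕ) :
    IsUnit (algebraMap A (Localization.Away h) (h ^ k)) := by
  rw [map_pow]
  exact (IsLocalization.Away.algebraMap_isUnit h).pow k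

theorem val_mk_mul {k : ℕ} {a : A} (ha : a ∈ 𝒜 (k • m)) :
    (Away.mk 𝒜 hh k a ha).val * algebraMap A (Localization.Away h) (h ^ k) = algebraMap A _ a := by
  rw [Away.val_mk, Localization.mk_eq_mk']
  exact IsLocalization.mk'_spec (S := Localization.Away h) a
    (⟨h ^ k, k, rfl⟩ : Submonoid.powers h)

theorem mk_sub_awayConst {k : ℕ} {a : A} (ha : a ∈ 𝒜 (k • m)) (c : ℂ)
    (hc : a - algebraMap ℂ A c * h ^ k ∈ 𝒜 (k • m)) :
    Away.mk 𝒜 hh k (a - algebraMap ℂ A c * h ^ k) hc = Away.mk 𝒜 hh k a ha - awayConst 𝒜 h c := by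
  apply val_injective
  apply (isUnit_algebraMap_pow h k).mul_right_cancel
  rw [val_sub, val_awayConst, sub_mul, val_mk_mul, val_mk_mul, map_sub, map_mul]

/-- The extension of `φ` to the ring of fractions `a / h ^ k` of degree zero. -/
def awayLift {K : Type} [Field K] [Algebra ℂ K] (φ : A →ₐ[ℂ] K) (hφ : φ h ≠ 0) :
    Away 𝒜 h →+* K :=
  (IsLocalization.Away.lift (S := Localization.Away h) h (g := φ.toRingHom) hφ.isUnit).comp
    (algebraMap (Away 𝒜 h) (Localization.Away h))

theorem awayLift_mk {K : Type} [Field K] [Algebra ℂ K] (φ : A →ₐ[ℂ] K) (hφ : φ h ≠ 0)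
    {k : ℕ} {a : A} (ha : a ∈ 𝒜 (k • m)) : awayLift φ hφ (Away.mk 𝒜 hh k a ha) * φ h ^ k = φ a := by
  let L := IsLocalization.Away.lift (S := Localization.Away h) h (g := φ.toRingHom) hφ.isUnit
  have hL (b : A) : L (algebraMap A _ b) = φ b := IsLocalization.Away.lift_eq h _ b
  change L ((Away.mk 𝒜 hh k a ha).val) * _ = _
  rw [← hL a, ← hL h, ← map_pow, ← map_pow, ← map_mul, val_mk_mul]

theorem awayLift_awayConst {K : Type} [Field K] [Algebra ℂ K] (φ : A →ₐ[ℂ] K) (hφ : φ h ≠ 0) :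
    (awayLift φ hφ).comp (awayConst 𝒜 h) = algebraMap ℂ K := by
  ext c
  let L := IsLocalization.Away.lift (S := Localization.Away h) h (g := φ.toRingHom) hφ.isUnit
  have hL (b : A) : L (algebraMap A _ b) = φ b := IsLocalization.Away.lift_eq h _ b
  change L ((awayConst 𝒜 h c).val) = _
  rw [val_awayConst, hL, φ.commutes]

end

/-! ### Images of rational curves in `Proj A` -/

section

/-- The field of fractions, inside `K`, of the image of a ring `R` over `k`. -/
def fractionsOf {k R K : Type} [Field k] [CommRing R] [Field K] [Algebra k K] (χ : R →+* K)
    (g : k →+* R) (hg : χ.comp g = algebraMap k K) : IntermediateField k K where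
  carrier := {r | ∃ a b, χ b ≠ 0 ∧ r * χ b = χ a}
  mul_mem' := by
    rintro r s ⟨a, b, hb, h1⟩ ⟨c, d, hd, h2⟩
    refine ⟨a * c, b * d, by rw [map_mul]; exact mul_ne_zero hb hd, ?_⟩
    rw [map_mul, map_mul, ← h1, ← h2]; ring
  add_mem' := by
    rintro r s ⟨a, b, hb, h1⟩ ⟨c, d, hd, h2⟩
    refine ⟨a * d + c * b, b * d, by rw [map_mul]; exact mul_ne_zero hb hd, ?_⟩
    rw [map_add, map_mul, map_mul, map_mul, ← h1, ← h2]; ring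
  algebraMap_mem' c := ⟨g c, 1, by simp, by rw [← hg]; simp⟩
  inv_mem' := by
    rintro r ⟨a, b, hb, h1⟩
    by_cases hr : r = 0
    · exact ⟨0, 1, by simp, by simp [hr]⟩
    · exact ⟨b, a, by rw [← h1]; exact mul_ne_zero hr hb, by rw [← h1]; field_simp⟩

theorem apply_mem_fractionsOf {k R K : Type} [Field k] [CommRing R] [Field K] [Algebra k K]
    {χ : R →+* K} {g : k →+* R} {hg : χ.comp g = algebraMap k K} (a : R) :
    χ a ∈ fractionsOf χ g hg := ⟨a, 1, by simp, by simp⟩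

/-- Lüroth's theorem: if `χ : R →+* k(t)` has a nonconstant value, then the fractions of its image
form a field isomorphic to `k(t)`, so that `χ` can be replaced by a homomorphism with the same
kernel whose image has `k(t)` as its field of fractions. -/
theorem exists_ringHom_of_luroth {k R : Type} [Field k] [CommRing R] (χ : R →+* RatFunc k)
    (g : k →+* R) (hg : χ.comp g = algebraMap k (RatFunc k)) (a₀ : R)
    (ha₀ : ∀ c, χ a₀ ≠ algebraMap k (RatFunc k) c) :
    ∃ ψ : R →+* RatFunc k, ψ.comp g = algebraMap k (RatFunc k) ∧ (∀ a, ψ a = 0 ↔ χ a = 0) ∧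
      ∀ r, ∃ a b, ψ b ≠ 0 ∧ r * ψ b = ψ a := by
  let E := fractionsOf χ g hg
  have hE : E ≠ ⊥ := by
    intro h
    have h1 : χ a₀ ∈ E := apply_mem_fractionsOf a₀
    rw [h, IntermediateField.mem_bot] at h1
    obtain ⟨c, hc⟩ := h1
    exact ha₀ c hc.symm
  let e := RatFunc.Luroth.algEquiv hE
  let χ' : R →+* E := χ.codRestrict E.toSubfield.toSubring
    fun a ↦ apply_mem_fractionsOf (hg := hg) a
  have hz (a : R) : e.symm (χ' a) = 0 ↔ χ a = 0 := by
    rw [map_eq_zero_iff _ e.symm.injective]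
    exact Subtype.ext_iff
  refine ⟨(e.symm : E →+* RatFunc k).comp χ', ?_, hz, ?_⟩
  · ext c
    have : χ' (g c) = algebraMap k E c := Subtype.ext (RingHom.congr_fun hg c)
    change e.symm (χ' (g c)) = _
    rw [this, e.symm.commutes]
  · intro r
    obtain ⟨a, b, hb, h1⟩ := (e r).2
    refine ⟨a, b, fun h ↦ hb ((hz b).1 h), e.injective ?_⟩
    change e (r * e.symm (χ' b)) = e (e.symm (χ' a))
    rw [map_mul, e.apply_symm_apply, e.apply_symm_apply]
    exact Subtype.ext h1

theorem exists_apply_ne_algebraMap {R : Type} (ψ : R → RatFunc ℂ)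
    (hψ : ∀ r, ∃ a b, ψ b ≠ 0 ∧ r * ψ b = ψ a) :
    ∃ α, ∀ c : ℂ, ψ α ≠ algebraMap ℂ (RatFunc ℂ) c := by
  by_contra! H
  choose ev hev using H
  obtain ⟨a, b, hb, h1⟩ := hψ RatFunc.X
  rw [hev, hev] at h1
  rw [hev] at hb
  have h2 : RatFunc.X = algebraMap ℂ (RatFunc ℂ) (ev a / ev b) := by
    rw [map_div₀, eq_div_iff hb, h1]
  have h3 : algebraMap (Polynomial ℂ) (RatFunc ℂ) Polynomial.X =
      algebraMap (Polynomial ℂ) (RatFunc ℂ) (Polynomial.C (ev a / ev b)) := by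
    rw [RatFunc.algebraMap_X, h2]
    rfl
  exact Polynomial.X_ne_C _ (RatFunc.algebraMap_injective ℂ h3)

variable {A : Type} [CommRing A] [Algebra ℂ A] {𝒜 : ℕ → Submodule ℂ A} [GradedAlgebra 𝒜]

variable {h : A} {m : ℕ} (hh : h ∈ 𝒜 m) (hm : 0 < m)

include hh hm in
/-- The image in `Proj A` of the curve parametrized by `φ` is a rational curve, if some fraction
`a / h ^ k` of degree zero is not constant on it. -/
theorem isRationalPoint_of_algHom (φ : A →ₐ[ℂ] RatFunc ℂ) (hφ : φ h ≠ 0) {k : ℕ} {a : A}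
    (ha : a ∈ 𝒜 (k • m)) (hnc : ∀ c : ℂ, φ a ≠ algebraMap ℂ (RatFunc ℂ) c * φ h ^ k) (P : Proj 𝒜)
    (hP : P.asHomogeneousIdeal = (RingHom.ker φ).homogeneousCore 𝒜) :
    IsRationalPoint (structureΓ 𝒜) P := by
  have hmem {n : ℕ} {g : A} (hg : g ∈ 𝒜 n) : g ∈ P.asHomogeneousIdeal ↔ φ g = 0 := by
    rw [hP, mem_homogeneousCore_iff_of_mem 𝒜 _ hg, RingHom.mem_ker]
  obtain ⟨ψ, h1, h2, h3⟩ := exists_ringHom_of_luroth (awayLift φ hφ) (awayConst 𝒜 h)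
    (awayLift_awayConst φ hφ) (Away.mk 𝒜 hh k a ha) fun c hc ↦ hnc c <| by
      rw [← hc, awayLift_mk]
  refine (isRationalPoint_proj_iff hh hm P (by rwa [hmem hh])).2 ⟨ψ, h1, fun n g hg ↦ ?_, h3⟩
  rw [h2, hmem hg, ← mul_left_inj' (pow_ne_zero n hφ), awayLift_mk, zero_mul, map_pow]
  exact pow_eq_zero_iff hm.ne'

variable [Algebra.FiniteType ℂ A]

theorem not_isMaximal_ker (φ : A →ₐ[ℂ] RatFunc ℂ) (hφ : ∀ r, ∃ a b, φ b ≠ 0 ∧ r * φ b = φ a) :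
    ¬ (RingHom.ker φ).IsMaximal := by
  intro hmax
  obtain ⟨ev, hev⟩ := exists_algHom_ker_eq (RingHom.ker φ)
  obtain ⟨a, ha⟩ := exists_apply_ne_algebraMap φ hφ
  have : a - algebraMap ℂ A (ev a) ∈ RingHom.ker φ := by
    rw [← hev, RingHom.mem_ker]; simp
  rw [RingHom.mem_ker, map_sub, sub_eq_zero, φ.commutes] at this
  exact ha _ this

include hh hm in
/-- A rational curve in `Spec A` on which all fractions of degree zero are constant is contained in,
and hence equal to, the closure of the orbit of each of its closed points outside `h = 0`. -/
theorem isOrbitClosure_of_forall_eq {Q : PrimeSpectrum A} (φ : A →ₐ[ℂ] RatFunc ℂ)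
    (hQ : RingHom.ker φ = Q.asIdeal) (hφ : ∀ r, ∃ a b, φ b ≠ 0 ∧ r * φ b = φ a)
    (H : ∀ k, ∀ a ∈ 𝒜 (k • m), ∃ c : ℂ, φ a = algebraMap ℂ (RatFunc ℂ) c * φ h ^ k)
    (x : PrimeSpectrum A) (hx : IsClosed {x}) (hQx : Q.asIdeal ≤ x.asIdeal) (hxh : h ∉ x.asIdeal) :
    IsOrbitClosure 𝒜 (closure {Q}) := by
  have hpow {n : ℕ} {a : A} (ha : a ∈ 𝒜 n) :
      ∃ c : ℂ, φ (a ^ m) = algebraMap ℂ (RatFunc ℂ) c * φ (h ^ n) := by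
    obtain ⟨c, hc⟩ := H n (a ^ m)
      (by rw [smul_eq_mul, mul_comm, ← smul_eq_mul]; exact SetLike.pow_mem_graded m ha)
    exact ⟨c, by rw [hc, map_pow]⟩
  have hmax : ¬ Q.asIdeal.IsMaximal := hQ ▸ not_isMaximal_ker φ hφ
  -- the homogeneous ideals of the point and of the curve agree
  have hcore : x.asIdeal.homogeneousCore 𝒜 = Q.asIdeal.homogeneousCore 𝒜 := by
    refine HomogeneousIdeal.ext' fun n a ha ↦ ?_
    rw [mem_homogeneousCore_iff_of_mem 𝒜 _ ha, mem_homogeneousCore_iff_of_mem 𝒜 _ ha]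
    refine ⟨fun hax ↦ ?_, fun h ↦ hQx h⟩
    obtain ⟨c, hc⟩ := hpow ha
    have h1 : a ^ m - algebraMap ℂ A c * h ^ n ∈ Q.asIdeal := by
      rw [← hQ, RingHom.mem_ker, map_sub, map_mul, hc, φ.commutes, sub_self]
    have h2 : algebraMap ℂ A c * h ^ n ∈ x.asIdeal := by
      simpa using sub_mem (Ideal.pow_mem_of_mem _ hax m hm) (hQx h1)
    have hc0 : c = 0 := by
      by_contra hc0
      rcases x.2.mem_or_mem h2 with h3 | h3
      · exact x.2.ne_top (Ideal.eq_top_of_isUnit_mem _ h3 ((IsUnit.mk0 c hc0).map (algebraMap ℂ A)))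
      · exact hxh (x.2.mem_of_pow_mem _ h3)
    rw [← hQ, RingHom.mem_ker]
    rw [hc0, map_zero, zero_mul, map_pow] at hc
    exact pow_eq_zero_iff hm.ne' |>.1 hc
  -- otherwise `Q` would be maximal, as the quotient by its core has dimension at most one
  have hQh : Q.asIdeal = (Q.asIdeal.homogeneousCore 𝒜).toIdeal := by
    by_contra hne
    have hp : (Q.asIdeal.homogeneousCore 𝒜).toIdeal.IsPrime := Q.2.homogeneousCore
    refine hmax (isMaximal_of_lt (𝒜 := 𝒜) (h := h) (m := m)
      (lt_of_le_of_ne (Ideal.toIdeal_homogeneousCore_le 𝒜 Q.asIdeal) (Ne.symm hne)) hm ?_)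
    intro n a ha
    obtain ⟨c, hc⟩ := hpow ha
    refine ⟨c, (mem_homogeneousCore_iff_of_mem 𝒜 _ (n := n • m) (sub_mem ?_ ?_)).2 ?_⟩
    · rw [smul_eq_mul, mul_comm, ← smul_eq_mul]; exact SetLike.pow_mem_graded m ha
    · rw [← Algebra.smul_def]
      exact Submodule.smul_mem _ _ (SetLike.pow_mem_graded n hh)
    · rw [← hQ, RingHom.mem_ker, map_sub, map_mul, hc, φ.commutes, sub_self]
  refine ⟨x, hx, ?_, ?_⟩
  · by_contra hno
    have h1 := asIdeal_eq_homogeneousCore_of_orbit_subsingleton 𝒜 x hno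
    rw [hcore, ← hQh] at h1
    exact hmax (h1 ▸ (PrimeSpectrum.isClosed_singleton_iff_isMaximal x).1 hx)
  · rw [closure_orbit, hcore, PrimeSpectrum.closure_singleton, hQh]
    simp

include hm in
/-- A homomorphism on fractions of degree zero is constant if its kernel contains the homogeneous
core of a maximal ideal, that is, if it corresponds to a closed point of `Proj A`. -/
theorem exists_eq_algebraMap_of_core_le {K : Type} [CommRing K] [Algebra ℂ K] [IsReduced K]
    (ψ : Away 𝒜 h →+* K)
    (hψ : ψ.comp (awayConst 𝒜 h) = algebraMap ℂ K) (P : Ideal A)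
    (hker : ∀ (n : ℕ) (g : A) (hg : g ∈ 𝒜 n), ψ (Away.isLocalizationElem hh hg) = 0 ↔ g ∈ P)
    (x : Ideal A) [x.IsMaximal] (hxh : h ∉ x) (hxP : (x.homogeneousCore 𝒜).toIdeal ≤ P)
    (α : Away 𝒜 h) : ∃ c : ℂ, ψ α = algebraMap ℂ K c := by
  obtain ⟨k, a, ha, rfl⟩ := Away.mk_surjective 𝒜 hh α
  obtain ⟨ev, hev⟩ := exists_algHom_ker_eq x
  have hxp : x.IsPrime := inferInstance
  let c := ev a / ev (h ^ k)
  have h1 := sub_algebraMap_mul_mem_homogeneousCore (𝒜 := 𝒜) hev ha (SetLike.pow_mem_graded k hh)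
    fun h ↦ hxh (hxp.mem_of_pow_mem _ h)
  have h2 : a - algebraMap ℂ A c * h ^ k ∈ 𝒜 (k • m) := by
    rw [← Algebra.smul_def]
    exact sub_mem ha (Submodule.smul_mem _ _ (SetLike.pow_mem_graded k hh))
  have h3 := (hker _ _ h2).2 (hxP h1)
  rw [isLocalizationElem_eq_pow, map_pow, pow_eq_zero_iff hm.ne', mk_sub_awayConst hh ha, map_sub,
    sub_eq_zero] at h3
  exact ⟨c, by rw [h3, ← hψ]; rfl⟩

include hm in
/-- In dimension two a nonconstant homomorphism on fractions of degree zero has kernel zero.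
Otherwise `0`, the prime `P`, the homogeneous core of a maximal ideal above `P` which omits `h`, and
the irrelevant ideal would form a strictly increasing chain. -/
theorem eq_bot_of_ringKrullDim_eq_two [IsDomain A]
    (hdim : ringKrullDim A = 2) (hmax : (HomogeneousIdeal.irrelevant 𝒜).toIdeal.IsMaximal)
    {K : Type} [CommRing K] [Algebra ℂ K] [IsReduced K] (ψ : Away 𝒜 h →+* K)
    (hψ : ψ.comp (awayConst 𝒜 h) = algebraMap ℂ K) (P : HomogeneousIdeal 𝒜) (hP : P.toIdeal.IsPrime)
    (hker : ∀ (n : ℕ) (g : A) (hg : g ∈ 𝒜 n), ψ (Away.isLocalizationElem hh hg) = 0 ↔ g ∈ P)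
    (hPh : h ∉ P) (α : Away 𝒜 h) (hα : ∀ c : ℂ, ψ α ≠ algebraMap ℂ K c) : P.toIdeal = ⊥ := by
  obtain ⟨x, hx, hPx, hxh⟩ := exists_isMaximal_ge_notMem P.toIdeal hPh
  have hxp : x.IsPrime := inferInstance
  have hxc : (x.homogeneousCore 𝒜).toIdeal.IsPrime := hxp.homogeneousCore
  by_contra hne
  have hle1 : P.toIdeal ≤ (x.homogeneousCore 𝒜).toIdeal :=
    (Ideal.homogeneousCore.gc 𝒜 P x).1 hPx
  have hlt1 : P.toIdeal < (x.homogeneousCore 𝒜).toIdeal := by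
    refine lt_of_le_of_ne hle1 fun he ↦ ?_
    obtain ⟨c, hc⟩ := exists_eq_algebraMap_of_core_le hh hm ψ hψ P.toIdeal hker x hxh he.ge α
    exact hα c hc
  have hlt2 : (x.homogeneousCore 𝒜).toIdeal < (HomogeneousIdeal.irrelevant 𝒜).toIdeal := by
    refine lt_of_le_of_ne (le_irrelevant hmax _ hxc.ne_top) fun he ↦ ?_
    have : h ∈ (x.homogeneousCore 𝒜).toIdeal := by
      rw [he]; exact HomogeneousIdeal.mem_irrelevant_of_mem 𝒜 hm hh
    exact hxh (Ideal.toIdeal_homogeneousCore_le 𝒜 x this)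
  let s : LTSeries (PrimeSpectrum A) :=
    { length := 3
      toFun := ![⊥, ⟨P.toIdeal, hP⟩, ⟨_, hxc⟩, ⟨_, hmax.isPrime⟩]
      step := by
        intro i
        fin_cases i
        · exact bot_lt_iff_ne_bot.2 hne
        · exact hlt1
        · exact hlt2 }
  have h3 := Order.LTSeries.length_le_krullDim s
  rw [← ringKrullDim, hdim] at h3
  exact absurd (by exact_mod_cast h3 : (3 : ℕ) ≤ 2) (by norm_num)

end

/-! ### From rational curves in `Spec A` to rational curves in `Proj A` -/

section

theorem exists_basicOpen_le {A : Type} [CommRing A] (U : (Spec (.of A)).Opens) (x : PrimeSpectrum A)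
    (hx : (x : Spec (.of A)) ∈ U) :
    ∃ g, g ∉ x.asIdeal ∧ ∀ y : PrimeSpectrum A, g ∉ y.asIdeal → (y : Spec (.of A)) ∈ U := by
  obtain ⟨_, ⟨g, rfl⟩, hg, hgU⟩ :=
    PrimeSpectrum.isTopologicalBasis_basic_opens.exists_subset_of_mem_open hx U.2
  exact ⟨g, hg, fun y hy ↦ hgU hy⟩

variable {A : Type} [CommRing A] [Algebra ℂ A] {𝒜 : ℕ → Submodule ℂ A} [GradedAlgebra 𝒜]

theorem exists_homogeneous_mem_basicOpen_subset (U : (Proj 𝒜).Opens) {y : Proj 𝒜} (hy : y ∈ U) :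
    ∃ (n : ℕ) (s : A), s ∈ 𝒜 n ∧ 0 < n ∧ s ∉ y.asHomogeneousIdeal ∧ Proj.basicOpen 𝒜 s ≤ U := by
  obtain ⟨_, ⟨s₀, rfl⟩, hys, hsU⟩ :=
    (ProjectiveSpectrum.isTopologicalBasis_basic_opens 𝒜).exists_subset_of_mem_open hy U.2
  have h1 : y ∈ Proj.basicOpen 𝒜 s₀ := hys
  rw [Proj.basicOpen_eq_iSup_proj, TopologicalSpace.Opens.mem_iSup] at h1
  obtain ⟨i, hi⟩ := h1
  have h2 := y.not_irrelevant_le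
  rw [HomogeneousIdeal.irrelevant_le] at h2
  push Not at h2
  obtain ⟨j, hj, h3⟩ := h2
  obtain ⟨t, ht, hty⟩ := SetLike.not_le_iff_exists.1 h3
  refine ⟨i + j, GradedRing.proj 𝒜 i s₀ * t, SetLike.mul_mem_graded (SetLike.coe_mem _) ht,
    by omega, fun h ↦ ?_, ?_⟩
  · rcases y.isPrime.mem_or_mem h with h | h
    exacts [hi h, hty h]
  · refine le_trans ?_ (show Proj.basicOpen 𝒜 s₀ ≤ U from hsU)
    rw [Proj.basicOpen_mul, Proj.basicOpen_eq_iSup_proj 𝒜 s₀]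
    exact inf_le_left.trans (le_iSup (fun i ↦ Proj.basicOpen 𝒜 (GradedRing.proj 𝒜 i s₀)) i)

variable {h : A} {m : ℕ} (hh : h ∈ 𝒜 m) (hm : 0 < m)

/-- The point of `Proj A` given by the homogeneous core of a prime ideal of `A` which omits a
homogeneous element of positive degree. -/
def coreProj (I : Ideal A) [hI : I.IsPrime] (hI' : h ∉ I) : Proj 𝒜 :=
  ⟨I.homogeneousCore 𝒜, hI.homogeneousCore, fun hle ↦ hI' <|
    Ideal.toIdeal_homogeneousCore_le 𝒜 I (hle (HomogeneousIdeal.mem_irrelevant_of_mem 𝒜 hm hh))⟩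

theorem mem_closure_proj_iff (y z : Proj 𝒜) :
    z ∈ closure {y} ↔ y.asHomogeneousIdeal ≤ z.asHomogeneousIdeal :=
  (ProjectiveSpectrum.le_iff_mem_closure 𝒜 y z).symm

include hh hm in
theorem nonempty_basicOpen [IsDomain A] (h0 : h ≠ 0) :
    (Proj.basicOpen 𝒜 h : Set (Proj 𝒜)).Nonempty :=
  ⟨coreProj hh hm ⊥ h0, fun h1 ↦ h0 (Ideal.toIdeal_homogeneousCore_le 𝒜 _ h1)⟩

theorem dense_proj_of_nonempty [IsDomain A] (U : (Proj 𝒜).Opens)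
    (hU : (U : Set (Proj 𝒜)).Nonempty) :
    Dense (U : Set (Proj 𝒜)) := by
  obtain ⟨y, hy⟩ := hU
  obtain ⟨n, s, hs, hn, hsy, -⟩ := exists_homogeneous_mem_basicOpen_subset U hy
  have hs0 : s ≠ 0 := fun h ↦ hsy (h ▸ zero_mem _)
  let η : Proj 𝒜 := coreProj hs hn ⊥ hs0
  have hη (z : Proj 𝒜) : z ∈ closure {η} := by
    rw [mem_closure_proj_iff]
    intro a ha
    have : a = 0 := Ideal.toIdeal_homogeneousCore_le 𝒜 ⊥ ha
    rw [this]; exact zero_mem _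
  have hηU : η ∈ U := (specializes_iff_mem_closure.2 (hη y)).mem_open U.2 hy
  exact fun z ↦ closure_mono (Set.singleton_subset_iff.2 hηU) (hη z)

theorem exists_homogeneous_component_ne_zero {a : A} (ha : a ≠ 0) :
    ∃ n, (DirectSum.decompose 𝒜 a n : A) ≠ 0 := by
  classical
  by_contra! H
  refine ha ?_
  rw [← DirectSum.sum_support_decompose 𝒜 a]
  exact Finset.sum_eq_zero fun n _ ↦ H n

variable [IsDomain A] [Algebra.FiniteType ℂ A]

/-- A closed point of `Proj A` in a suitable basic open set lies below a general closed point of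
`Spec A`, and the rational curve through the latter has a rational curve in `Proj A` as its image.
-/
theorem isQuasirational_of_hasGeneralRationalCurves
    (hmax : (HomogeneousIdeal.irrelevant 𝒜).toIdeal.IsMaximal)
    (H : HasGeneralRationalCurves 𝒜) : IsQuasirational 𝒜 := by
  obtain ⟨U, ⟨u, hu⟩, -, H⟩ := H
  replace H (x : PrimeSpectrum A) (hxU : (x : Spec (.of A)) ∈ U) (hx : IsClosed {x}) :
      ∃ (Q : PrimeSpectrum A) (φ : A →ₐ[ℂ] RatFunc ℂ), Q.asIdeal ≤ x.asIdeal ∧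
        RingHom.ker φ = Q.asIdeal ∧ (∀ r, ∃ a b, φ b ≠ 0 ∧ r * φ b = φ a) ∧
        ¬ IsOrbitClosure 𝒜 (closure {Q}) := by
    obtain ⟨C, ι, h1, h2, h3⟩ := H x hxU hx
    obtain ⟨Q, h4, h5⟩ := h1.exists_isRationalPoint
    obtain ⟨φ, h6, h7⟩ := (isRationalPoint_spec_iff Q).1 h4
    rw [h5] at h2
    refine ⟨Q, φ, ?_, h6, h7,
      fun hc ↦ h3 ((iff_of_eq (congrArg (IsOrbitClosure 𝒜) h5)).2 hc)⟩
    exact (PrimeSpectrum.le_iff_mem_closure Q x).2 h2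
  obtain ⟨g, hg, hgU⟩ := exists_basicOpen_le U u hu
  have hg0 : g ≠ 0 := fun h ↦ hg (h ▸ zero_mem _)
  have hirr : (HomogeneousIdeal.irrelevant 𝒜).toIdeal ≠ ⊥ := by
    intro hbot
    rw [hbot] at hmax
    obtain ⟨Q, φ, h1, h2, h3, -⟩ := H ⟨⊥, Ideal.isPrime_bot⟩ (hgU _ hg0)
      ((PrimeSpectrum.isClosed_singleton_iff_isMaximal _).2 hmax)
    refine not_isMaximal_ker φ h3 ?_
    rw [h2, le_bot_iff.1 h1]
    exact hmax
  obtain ⟨s, hs, hs0⟩ := Submodule.exists_mem_ne_zero_of_ne_bot hirr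
  obtain ⟨j, hj⟩ := exists_homogeneous_component_ne_zero (𝒜 := 𝒜) hs0
  have hj0 : 0 < j := by
    rw [Nat.pos_iff_ne_zero]
    rintro rfl
    exact hj ((HomogeneousIdeal.mem_irrelevant_iff 𝒜 s).1 hs)
  obtain ⟨i, hi⟩ := exists_homogeneous_component_ne_zero (𝒜 := 𝒜) hg0
  -- on `D₊(h)` points of `Proj A` lift to points of `U`: a component of `g` does not vanish there
  obtain ⟨h, hhdef⟩ : ∃ h, h = (DirectSum.decompose 𝒜 g i : A) * (DirectSum.decompose 𝒜 s j : A) :=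
    ⟨_, rfl⟩
  have hh : h ∈ 𝒜 (i + j) := hhdef ▸ SetLike.mul_mem_graded (SetLike.coe_mem _) (SetLike.coe_mem _)
  have hm : 0 < i + j := by omega
  have hh0 : h ≠ 0 := hhdef ▸ mul_ne_zero hi hj
  refine ⟨Proj.basicOpen 𝒜 h, nonempty_basicOpen hh hm hh0,
    dense_proj_of_nonempty _ (nonempty_basicOpen hh hm hh0), fun y hy hyc ↦ ?_⟩
  have hyp := y.isPrime
  have hgy : g * h ∉ y.asHomogeneousIdeal.toIdeal := by
    intro hmem
    refine hy ((hyp.mem_or_mem hmem).elim (fun hgy ↦ ?_) id)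
    rw [hhdef]
    exact Ideal.mul_mem_right _ _ ((y.asHomogeneousIdeal.isHomogeneous.mem_iff).1 hgy i)
  obtain ⟨x, hx, hyx, hxgh⟩ := exists_isMaximal_ge_notMem y.asHomogeneousIdeal.toIdeal hgy
  have hxp : x.IsPrime := inferInstance
  have hxg : g ∉ x := fun h' ↦ hxgh (Ideal.mul_mem_right _ _ h')
  have hxh : h ∉ x := fun h' ↦ hxgh (Ideal.mul_mem_left _ _ h')
  have hyz : coreProj hh hm x hxh = y := by
    have : coreProj hh hm x hxh ∈ closure {y} :=
      (mem_closure_proj_iff _ _).2 ((Ideal.homogeneousCore.gc 𝒜 _ x).1 hyx)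
    rwa [hyc.closure_eq] at this
  have hxc : IsClosed {(⟨x, hxp⟩ : PrimeSpectrum A)} :=
    (PrimeSpectrum.isClosed_singleton_iff_isMaximal _).2 hx
  obtain ⟨Q, φ, hQx, hQ, hφ, hno⟩ := H ⟨x, hxp⟩ (hgU _ hxg) hxc
  have hφh : φ h ≠ 0 := fun h0 ↦ hxh (hQx (hQ ▸ (RingHom.mem_ker.2 h0)))
  have hex : ∃ k, ∃ a ∈ 𝒜 (k • (i + j)), ∀ c : ℂ, φ a ≠ algebraMap ℂ (RatFunc ℂ) c * φ h ^ k := by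
    by_contra! H'
    exact hno (isOrbitClosure_of_forall_eq hh hm φ hQ hφ H' ⟨x, hxp⟩ hxc hQx hxh)
  obtain ⟨k, a, ha, hnc⟩ := hex
  have hker : (RingHom.ker φ).IsPrime := RingHom.ker_isPrime _
  obtain ⟨C, ι, hC, hr⟩ := (isRationalPoint_of_algHom hh hm φ hφh ha hnc
    (coreProj hh hm (RingHom.ker φ) hφh) rfl).exists_isClosedRationalCurve
  refine ⟨C, ι, hC, ?_⟩
  rw [hr, mem_closure_proj_iff, ← hyz]
  exact Ideal.homogeneousCore_mono 𝒜 (hQ ▸ hQx)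

end

/-! ### Lifting rational curves from `Proj A` to `Spec A` -/

section

variable {A : Type} [CommRing A] [Algebra ℂ A] (𝒜 : ℕ → Submodule ℂ A) [GradedAlgebra 𝒜]

/-- The degrees of homogeneous fractions form a subgroup of `ℤ`. Its generator `d` is the degree of
a fraction `f / g`. -/
theorem exists_degree_generator [IsDomain A] :
    ∃ (d e : ℕ) (f g : A), f ∈ 𝒜 (e + d) ∧ g ∈ 𝒜 e ∧ f ≠ 0 ∧ g ≠ 0 ∧
      ∀ n, ∀ a ∈ 𝒜 n, a ≠ 0 → d ∣ n := by
  let S : AddSubgroup ℤ :=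
    { carrier := {r | ∃ (i j : ℕ) (a b : A), a ∈ 𝒜 i ∧ b ∈ 𝒜 j ∧ a ≠ 0 ∧ b ≠ 0 ∧ r = i - j}
      zero_mem' := ⟨0, 0, 1, 1, SetLike.one_mem_graded 𝒜, SetLike.one_mem_graded 𝒜, one_ne_zero,
        one_ne_zero, by simp⟩
      add_mem' := by
        rintro _ _ ⟨i, j, a, b, ha, hb, ha0, hb0, rfl⟩ ⟨i', j', a', b', ha', hb', ha0', hb0', rfl⟩
        exact ⟨i + i', j + j', a * a', b * b', SetLike.mul_mem_graded ha ha',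
          SetLike.mul_mem_graded hb hb', mul_ne_zero ha0 ha0', mul_ne_zero hb0 hb0',
          by push_cast; ring⟩
      neg_mem' := by
        rintro _ ⟨i, j, a, b, ha, hb, ha0, hb0, rfl⟩
        exact ⟨j, i, b, a, hb, ha, hb0, ha0, by ring⟩ }
  obtain ⟨r, hr⟩ := Int.subgroup_cyclic S
  have hr' : S = AddSubgroup.zmultiples (r.natAbs : ℤ) := by
    rw [hr, ← AddSubgroup.zmultiples_eq_closure, Int.zmultiples_natAbs]
  obtain ⟨i, j, a, b, ha, hb, ha0, hb0, hij⟩ : (r.natAbs : ℤ) ∈ S := by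
    rw [hr']; exact AddSubgroup.mem_zmultiples _
  refine ⟨r.natAbs, j, a, b, ?_, hb, ha0, hb0, fun n c hc hc0 ↦ ?_⟩
  · have : i = j + r.natAbs := by omega
    rwa [← this]
  · have : (n : ℤ) ∈ S :=
      ⟨n, 0, c, 1, hc, SetLike.one_mem_graded 𝒜, hc0, one_ne_zero, by simp⟩
    rw [hr', Int.mem_zmultiples_iff] at this
    exact_mod_cast this

variable {𝒜} {d e l : ℕ} {f g s : A} (hf : f ∈ 𝒜 (e + d)) (hg : g ∈ 𝒜 e) (hs : s ∈ 𝒜 l)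
  (hd : ∀ n, ∀ a ∈ 𝒜 n, a ≠ 0 → d ∣ n)

include hf hg hs in
theorem mul_mul_mem : f * g * s ∈ 𝒜 (e + d + e + l) :=
  SetLike.mul_mem_graded (SetLike.mul_mem_graded hf hg) hs

include hg hs hd in
theorem dehomogenize_mem {n : ℕ} {a : A} (ha : a ∈ 𝒜 n) :
    a * (g * (g * s)) ^ (n / d) ∈ 𝒜 ((n / d) • (e + d + e + l)) := by
  rcases eq_or_ne a 0 with rfl | ha0
  · rw [zero_mul]; exact zero_mem _
  · have h1 := SetLike.mul_mem_graded ha (SetLike.pow_mem_graded (n / d)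
      (SetLike.mul_mem_graded hg (SetLike.mul_mem_graded hg hs)))
    convert h1 using 2
    obtain ⟨k, rfl⟩ := hd n a ha ha0
    rcases Nat.eq_zero_or_pos d with rfl | hd0
    · simp
    · rw [Nat.mul_div_cancel_left k hd0]
      simp only [smul_eq_mul]
      ring

/-- The map `a ↦ a / (f / g) ^ (n / d)` from homogeneous elements of degree `n` to fractions of
degree zero. To have a power of `f * g * s` as denominator, the fraction is extended by
`(g * s) ^ (n / d)`. The quotient `n / d` is exact unless `a = 0`. -/
def dehomogenizeDegree (n : ℕ) : 𝒜 n →+ Away 𝒜 (f * g * s) where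
  toFun a := Away.mk 𝒜 (mul_mul_mem hf hg hs) (n / d) (a * (g * (g * s)) ^ (n / d))
    (dehomogenize_mem hg hs hd a.2)
  map_zero' := by
    apply val_injective
    apply (isUnit_algebraMap_pow _ (n / d)).mul_right_cancel
    rw [val_mk_mul]
    simp
  map_add' a b := by
    apply val_injective
    apply (isUnit_algebraMap_pow _ (n / d)).mul_right_cancel
    rw [val_mk_mul, val_add, add_mul, val_mk_mul, val_mk_mul, ← map_add]
    simp [add_mul]

theorem isUnit_algebraMap_of_dvd {A : Type} [CommRing A] {h a : A} (ha : a ∣ h) :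
    IsUnit (algebraMap A (Localization.Away h) a) :=
  isUnit_of_dvd_unit (map_dvd _ ha) (IsLocalization.Away.algebraMap_isUnit h)

theorem val_dehomogenizeDegree_mul {n : ℕ} (a : 𝒜 n) :
    (dehomogenizeDegree hf hg hs hd n a).val * algebraMap A _ f ^ (n / d) =
      algebraMap A (Localization.Away (f * g * s)) a * algebraMap A _ g ^ (n / d) := by
  have h1 := val_mk_mul (mul_mul_mem hf hg hs) (dehomogenize_mem hg hs hd a.2)
  have hu : IsUnit (algebraMap A (Localization.Away (f * g * s)) (g * s) ^ (n / d)) :=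
    (isUnit_algebraMap_of_dvd ⟨f, by ring⟩).pow _
  apply hu.mul_right_cancel
  calc _ = (dehomogenizeDegree hf hg hs hd n a).val *
        algebraMap A _ ((f * g * s) ^ (n / d)) := by
        simp only [map_mul, map_pow]; ring
    _ = _ := h1
    _ = _ := by simp only [map_mul, map_pow]; ring

theorem dehomogenizeDegree_eq_iff {n : ℕ} (a : 𝒜 n) (α : Away 𝒜 (f * g * s)) :
    dehomogenizeDegree hf hg hs hd n a = α ↔ α.val * algebraMap A _ f ^ (n / d) =
      algebraMap A (Localization.Away (f * g * s)) a * algebraMap A _ g ^ (n / d) := by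
  have hu : IsUnit (algebraMap A (Localization.Away (f * g * s)) f ^ (n / d)) :=
    (isUnit_algebraMap_of_dvd ⟨g * s, by ring⟩).pow _
  rw [← (val_injective _).eq_iff, ← hu.mul_left_inj, val_dehomogenizeDegree_mul, eq_comm]

theorem dehomogenizeDegree_mul {i j : ℕ} (a : 𝒜 i) (b : 𝒜 j) :
    (Polynomial.monomial ((i + j) / d)) (dehomogenizeDegree hf hg hs hd (i + j)
      ⟨a * b, SetLike.mul_mem_graded a.2 b.2⟩) =
    Polynomial.monomial (i / d) (dehomogenizeDegree hf hg hs hd i a) *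
      Polynomial.monomial (j / d) (dehomogenizeDegree hf hg hs hd j b) := by
  rcases eq_or_ne a 0 with rfl | ha
  · have : (⟨_, SetLike.mul_mem_graded (0 : 𝒜 i).2 b.2⟩ : 𝒜 (i + j)) = 0 := Subtype.ext (by simp)
    rw [this]; simp
  rcases eq_or_ne b 0 with rfl | hb
  · have : (⟨_, SetLike.mul_mem_graded a.2 (0 : 𝒜 j).2⟩ : 𝒜 (i + j)) = 0 := Subtype.ext (by simp)
    rw [this]; simp
  have hi := hd i a a.2 (by simpa using ha)
  rw [Polynomial.monomial_mul_monomial, Nat.add_div_of_dvd_right hi]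
  congr 1
  rw [dehomogenizeDegree_eq_iff, Nat.add_div_of_dvd_right hi, val_mul, map_mul, pow_add,
    pow_add, mul_mul_mul_comm, val_dehomogenizeDegree_mul, val_dehomogenizeDegree_mul]
  ring

open scoped DirectSum in
/-- Dehomogenization with respect to `f / g`: the homomorphism from `A` to the polynomial ring in
one variable `T` over the fractions of degree zero which sends `a` of degree `n` to
`(a / (f / g) ^ (n / d)) * T ^ (n / d)`. -/
def dehomogenize : A →+* Polynomial (Away 𝒜 (f * g * s)) :=
  (DirectSum.toSemiring (A := fun n ↦ 𝒜 n)
    (fun n ↦ (Polynomial.monomial (n / d)).toAddMonoidHom.comp (dehomogenizeDegree hf hg hs hd n))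
    (by
      change Polynomial.monomial (0 / d) (dehomogenizeDegree hf hg hs hd 0 1) = 1
      rw [Nat.zero_div, Polynomial.monomial_zero_left, ← Polynomial.C_1]
      congr 1
      rw [dehomogenizeDegree_eq_iff]
      simp)
    (fun a b ↦ dehomogenizeDegree_mul hf hg hs hd a b)).comp
    (DirectSum.decomposeRingEquiv 𝒜 : A →+* ⨁ n, 𝒜 n)

theorem dehomogenize_of_mem {n : ℕ} {a : A} (ha : a ∈ 𝒜 n) :
    dehomogenize hf hg hs hd a =
      Polynomial.monomial (n / d) (dehomogenizeDegree hf hg hs hd n ⟨a, ha⟩) := by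
  rw [dehomogenize, RingHom.comp_apply]
  have : (DirectSum.decomposeRingEquiv 𝒜 : A →+* _) a = DirectSum.of (fun n ↦ 𝒜 n) n ⟨a, ha⟩ :=
    DirectSum.decompose_of_mem 𝒜 ha
  rw [this]
  exact DirectSum.toSemiring_of _ _ _ n _

theorem dehomogenize_algebraMap (c : ℂ) :
    dehomogenize hf hg hs hd (algebraMap ℂ A c) = Polynomial.C (awayConst 𝒜 (f * g * s) c) := by
  rw [dehomogenize_of_mem hf hg hs hd (SetLike.algebraMap_mem_graded 𝒜 c), Nat.zero_div,
    Polynomial.monomial_zero_left]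
  congr 1
  rw [dehomogenizeDegree_eq_iff, val_awayConst, Nat.zero_div, pow_zero, pow_zero]

theorem dehomogenize_numerator (hd0 : 0 < d) :
    dehomogenize hf hg hs hd f = Polynomial.X * dehomogenize hf hg hs hd g := by
  rw [dehomogenize_of_mem hf hg hs hd hf, dehomogenize_of_mem hf hg hs hd hg,
    Polynomial.X_mul_monomial]
  have h1 : (e + d) / d = e / d + 1 := Nat.add_div_right e hd0
  rw [h1]
  congr 1
  rw [dehomogenizeDegree_eq_iff, h1, pow_succ, ← mul_assoc, val_dehomogenizeDegree_mul]
  ring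

theorem dehomogenize_mk (hh0 : f * g * s ≠ 0) {k : ℕ} {a : A}
    (ha : a ∈ 𝒜 (k • (e + d + e + l))) :
    dehomogenize hf hg hs hd a = Polynomial.C (Away.mk 𝒜 (mul_mul_mem hf hg hs) k a ha) *
      dehomogenize hf hg hs hd (f * g * s) ^ k := by
  have hdvd := hd _ _ (mul_mul_mem hf hg hs) hh0
  rw [dehomogenize_of_mem hf hg hs hd ha, dehomogenize_of_mem hf hg hs hd (mul_mul_mem hf hg hs),
    Polynomial.monomial_pow, Polynomial.C_mul_monomial]
  have h1 : k • (e + d + e + l) / d = (e + d + e + l) / d * k := by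
    rw [smul_eq_mul, Nat.mul_div_assoc _ hdvd, mul_comm]
  rw [h1]
  congr 1
  have h2 := val_dehomogenizeDegree_mul hf hg hs hd ⟨f * g * s, mul_mul_mem hf hg hs⟩
  have h3 := val_mk_mul (mul_mul_mem hf hg hs) ha
  rw [map_pow] at h3
  have key {R : Type} [CommRing R] {x y F G a h : R} (h2 : x * F = h * G) (h3 : y * h ^ k = a) :
      y * x ^ k * F ^ k = a * G ^ k := by
    rw [mul_assoc, ← mul_pow, h2, mul_pow, ← mul_assoc, h3]
  rw [dehomogenizeDegree_eq_iff, h1, pow_mul, pow_mul, val_mul, val_pow]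
  exact key h2 h3

/-- Distinct degrees `n` with a nonzero component have distinct quotients `n / d`, so that
components of different degrees do not cancel. -/
theorem dehomogenize_injective [IsDomain A] (hh0 : f * g * s ≠ 0) :
    Function.Injective (dehomogenize hf hg hs hd) := by
  classical
  refine (injective_iff_map_eq_zero _).2 fun a ha ↦ ?_
  by_contra ha0
  obtain ⟨n, hn⟩ := exists_homogeneous_component_ne_zero (𝒜 := 𝒜) ha0
  have h1 : (dehomogenize hf hg hs hd a).coeff (n / d) =
      dehomogenizeDegree hf hg hs hd n (DirectSum.decompose 𝒜 a n) := by
    conv_lhs => rw [← DirectSum.sum_support_decompose 𝒜 a, map_sum, Polynomial.finsetSum_coeff]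
    rw [Finset.sum_eq_single n]
    · rw [dehomogenize_of_mem hf hg hs hd (SetLike.coe_mem _), Polynomial.coeff_monomial_same]
    · intro i hi hin
      rw [dehomogenize_of_mem hf hg hs hd (SetLike.coe_mem _), Polynomial.coeff_monomial_of_ne]
      intro h
      refine hin ?_
      have hi0 : (DirectSum.decompose 𝒜 a i : A) ≠ 0 := by simpa using hi
      rw [← Nat.mul_div_cancel' (hd n _ (SetLike.coe_mem _) hn), h,
        Nat.mul_div_cancel' (hd i _ (SetLike.coe_mem _) hi0)]
    · intro h
      exact absurd (by simpa using h) hn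
  rw [ha, Polynomial.coeff_zero, eq_comm, dehomogenizeDegree_eq_iff, val_zero, zero_mul,
    ← map_pow, ← map_mul, eq_comm, map_eq_zero_iff _ (IsLocalization.injective _
      (powers_le_nonZeroDivisors_of_noZeroDivisors hh0))] at h1
  have hg0 : g ≠ 0 := by rintro rfl; exact hh0 (by ring)
  exact mul_ne_zero hn (pow_ne_zero _ hg0) h1

theorem ringHom_ext_of_homogeneous {A R : Type} [CommRing A] [Algebra ℂ A] {𝒜 : ℕ → Submodule ℂ A}
    [GradedAlgebra 𝒜] [CommRing R] {φ ψ : A →+* R}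
    (H : ∀ n, ∀ a ∈ 𝒜 n, φ a = ψ a) : φ = ψ := by
  classical
  ext a
  rw [← DirectSum.sum_support_decompose 𝒜 a, map_sum, map_sum]
  exact Finset.sum_congr rfl fun n _ ↦ H n _ (SetLike.coe_mem _)

variable [Algebra.FiniteType ℂ A]

/-- A rational curve in `Proj A` through the image of the closed point `x` lifts to a rational curve
in `Spec A` through `x` which is not an orbit closure. It is obtained from dehomogenization by
giving to the variable the constant value `(f / g) (x)`. -/
theorem exists_rational_section {f g s : A} (hf : f ∈ 𝒜 (e + d)) (hg : g ∈ 𝒜 e) (hs : s ∈ 𝒜 l)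
    (hd : ∀ n, ∀ a ∈ 𝒜 n, a ≠ 0 → d ∣ n) (hd0 : 0 < d)
    (x : PrimeSpectrum A) (hx : IsClosed {x}) (hxh : f * g * s ∉ x.asIdeal)
    (P : Ideal A) (hPx : P ≤ x.asIdeal) (ψ : Away 𝒜 (f * g * s) →+* RatFunc ℂ)
    (hψ : ψ.comp (awayConst 𝒜 (f * g * s)) = algebraMap ℂ (RatFunc ℂ))
    (hker : ∀ (n : ℕ) (a : A) (ha : a ∈ 𝒜 n),
      ψ (Away.isLocalizationElem (mul_mul_mem hf hg hs) ha) = 0 ↔ a ∈ P)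
    (hfrac : ∀ r, ∃ a b, ψ b ≠ 0 ∧ r * ψ b = ψ a) :
    ∃ (Q : PrimeSpectrum A) (φ : A →ₐ[ℂ] RatFunc ℂ), Q.asIdeal ≤ x.asIdeal ∧
        RingHom.ker φ = Q.asIdeal ∧ (∀ r, ∃ a b, φ b ≠ 0 ∧ r * φ b = φ a) ∧
        ¬ IsOrbitClosure 𝒜 (closure {Q}) := by
  have hxm : x.asIdeal.IsMaximal := (PrimeSpectrum.isClosed_singleton_iff_isMaximal x).1 hx
  obtain ⟨ev, hev⟩ := exists_algHom_ker_eq x.asIdeal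
  have hev' (a : A) : ev a = 0 ↔ a ∈ x.asIdeal := by rw [← hev]; rfl
  have hevh : ev (f * g * s) ≠ 0 := by rwa [Ne, hev']
  have hevf : ev f ≠ 0 := fun h ↦ hevh (by rw [map_mul, map_mul, h]; ring)
  have hevg : ev g ≠ 0 := fun h ↦ hevh (by rw [map_mul, map_mul, h]; ring)
  have hmm := mul_mul_mem hf hg hs
  have hm0 : 0 < e + d + e + l := by omega
  -- substitute for the variable of the dehomogenization the value of `f / g` at `x`
  let c : ℂ := ev f / ev g
  let D := dehomogenize hf hg hs hd
  let Φ : A →+* Away 𝒜 (f * g * s) :=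
    (Polynomial.evalRingHom (awayConst 𝒜 (f * g * s) c)).comp D
  have hΦc (z : ℂ) : Φ (algebraMap ℂ A z) = awayConst 𝒜 _ z := by
    change Polynomial.eval _ (D _) = _
    rw [dehomogenize_algebraMap, Polynomial.eval_C]
  have hΦf : Φ f = awayConst 𝒜 _ c * Φ g := by
    change Polynomial.eval _ (D _) = _ * Polynomial.eval _ (D _)
    rw [dehomogenize_numerator hf hg hs hd hd0, Polynomial.eval_mul, Polynomial.eval_X]
  have hΦmk {k : ℕ} {a : A} (ha : a ∈ 𝒜 (k • (e + d + e + l))) :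
      Φ a = Away.mk 𝒜 hmm k a ha * Φ (f * g * s) ^ k := by
    change Polynomial.eval _ (D _) = _ * Polynomial.eval _ (D _) ^ k
    rw [dehomogenize_mk hf hg hs hd (fun h ↦ hevh (by rw [h, map_zero])) ha, Polynomial.eval_mul,
      Polynomial.eval_C, Polynomial.eval_pow]
  -- evaluation at `x` factors through `Φ`
  let evL := awayLift (𝒜 := 𝒜) ev hevh
  have hevΦ : evL.comp Φ = ev := by
    refine ringHom_ext_of_homogeneous (𝒜 := 𝒜) fun n a ha ↦ ?_
    rcases eq_or_ne a 0 with rfl | ha0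
    · simp
    have h1 : Φ a = dehomogenizeDegree hf hg hs hd n ⟨a, ha⟩ *
        awayConst 𝒜 (f * g * s) c ^ (n / d) := by
      change Polynomial.eval _ (D _) = _
      rw [dehomogenize_of_mem hf hg hs hd ha, Polynomial.eval_monomial]
    have h2 : evL (dehomogenizeDegree hf hg hs hd n ⟨a, ha⟩) * ev (f * g * s) ^ (n / d) =
        ev (a * (g * (g * s)) ^ (n / d)) :=
      awayLift_mk hmm ev hevh (dehomogenize_mem hg hs hd ha)
    have h3 : evL (awayConst 𝒜 (f * g * s) c) = c :=
      RingHom.congr_fun (awayLift_awayConst ev hevh) c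
    have h4 : ev (f * g * s) = c * ev (g * (g * s)) := by
      simp only [map_mul, c]
      field_simp
    change evL (Φ a) = ev a
    have h5 : ev (g * (g * s)) ≠ 0 := by
      intro h; rw [h, mul_zero] at h4; exact hevh h4
    refine mul_right_cancel₀ (pow_ne_zero (n / d) h5) ?_
    rw [h1, map_mul, map_pow, h3, mul_assoc, ← mul_pow, ← h4, h2, map_mul, map_pow]
  have hkerle (α : Away 𝒜 (f * g * s)) (hα : ψ α = 0) : evL α = 0 := by
    obtain ⟨k, a, ha, rfl⟩ := Away.mk_surjective 𝒜 hmm α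
    have h1 : a ∈ P := by
      rw [← hker _ a ha, isLocalizationElem_eq_pow, map_pow, hα, zero_pow hm0.ne']
    have h2 := awayLift_mk hmm ev hevh ha
    rw [(hev' a).2 (hPx h1)] at h2
    exact (mul_eq_zero.1 h2).resolve_right (pow_ne_zero k hevh)
  let φ : A →ₐ[ℂ] RatFunc ℂ :=
    { ψ.comp Φ with
      commutes' := fun z ↦ by
        change ψ (Φ (algebraMap ℂ A z)) = _
        rw [hΦc, ← hψ]
        rfl }
  have hφ (a : A) : φ a = ψ (Φ a) := rfl
  have hφx {a : A} (ha : φ a = 0) : a ∈ x.asIdeal := by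
    rw [← hev', ← hkerle _ ha]
    exact (RingHom.congr_fun hevΦ a).symm
  have hφh : φ (f * g * s) ≠ 0 := fun h ↦ hxh (hφx h)
  have hφmk {k : ℕ} {a : A} (ha : a ∈ 𝒜 (k • (e + d + e + l))) :
      φ a = ψ (Away.mk 𝒜 hmm k a ha) * φ (f * g * s) ^ k := by
    rw [hφ, hΦmk ha, map_mul, map_pow, hφ]
  refine ⟨⟨RingHom.ker φ, RingHom.ker_isPrime _⟩, φ, fun a ha ↦ hφx ha, rfl,
    fun r ↦ ?_, fun ho ↦ ?_⟩
  · obtain ⟨α, β, hβ, hr⟩ := hfrac r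
    obtain ⟨k, a, ha, rfl⟩ := Away.mk_surjective 𝒜 hmm α
    obtain ⟨k', b, hb, rfl⟩ := Away.mk_surjective 𝒜 hmm β
    refine ⟨a * (f * g * s) ^ k', b * (f * g * s) ^ k, ?_, ?_⟩
    · rw [map_mul, map_pow, hφmk hb]
      exact mul_ne_zero (mul_ne_zero hβ (pow_ne_zero _ hφh)) (pow_ne_zero _ hφh)
    · rw [map_mul, map_mul, map_pow, map_pow, hφmk hb, hφmk ha, ← hr]
      ring
  · -- `f - c g` lies in the ideal of the curve, but its component `f` does not
    have hhom := ho.isHomogeneous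
    have hmem : f - algebraMap ℂ A c * g ∈ RingHom.ker φ := by
      rw [RingHom.mem_ker, map_sub, map_mul, hφ, hφ g, hΦf, map_mul, φ.commutes, ← hψ]
      exact sub_self _
    have h1 := (hhom.mem_iff).1 hmem (e + d)
    have h2 : algebraMap ℂ A c * g ∈ 𝒜 e := by
      rw [← Algebra.smul_def]; exact Submodule.smul_mem _ _ hg
    rw [DirectSum.decompose_sub, DirectSum.sub_apply, AddSubgroupClass.coe_sub,
      DirectSum.decompose_of_mem_same 𝒜 hf,
      DirectSum.decompose_of_mem_ne 𝒜 h2 (by omega), sub_zero] at h1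
    exact hevf ((hev' f).2 (hφx h1))

variable [IsDomain A]

/-- If `Proj A` is uniruled, there is a chart `D₊(f * g * s)`, with `f / g` a fraction of the least
positive degree `d`, such that through the image of each closed point `x` of the chart there is a
rational curve. -/
theorem IsQuasirational.exists_chart (H : IsQuasirational 𝒜) :
    ∃ (d e l : ℕ) (f g s : A) (hf : f ∈ 𝒜 (e + d)) (hg : g ∈ 𝒜 e) (hs : s ∈ 𝒜 l)
      (_ : ∀ n, ∀ a ∈ 𝒜 n, a ≠ 0 → d ∣ n), 0 < d ∧ f * g * s ≠ 0 ∧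
      ∀ x : PrimeSpectrum A, IsClosed {x} → f * g * s ∉ x.asIdeal →
        ∃ (P : Proj 𝒜) (ψ : Away 𝒜 (f * g * s) →+* RatFunc ℂ),
          P.asHomogeneousIdeal.toIdeal ≤ x.asIdeal ∧
          ψ.comp (awayConst 𝒜 (f * g * s)) = algebraMap ℂ (RatFunc ℂ) ∧
          (∀ (n : ℕ) (a : A) (ha : a ∈ 𝒜 n),
            ψ (Away.isLocalizationElem (mul_mul_mem hf hg hs) ha) = 0 ↔ a ∈ P.asHomogeneousIdeal) ∧
          ∀ r, ∃ a b, ψ b ≠ 0 ∧ r * ψ b = ψ a := by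
  obtain ⟨U, ⟨y₀, hy₀⟩, -, H⟩ := H
  obtain ⟨l, s, hs, hl, hsy, hsU⟩ := exists_homogeneous_mem_basicOpen_subset U hy₀
  have hs0 : s ≠ 0 := fun h ↦ hsy (h ▸ zero_mem _)
  obtain ⟨d, e, f, g, hf, hg, hf0, hg0, hd⟩ := exists_degree_generator (𝒜 := 𝒜)
  have hd0 : 0 < d := Nat.pos_of_dvd_of_pos (hd l s hs hs0) hl
  have hmm := mul_mul_mem hf hg hs
  have hm0 : 0 < e + d + e + l := by omega
  have hh0 : f * g * s ≠ 0 := mul_ne_zero (mul_ne_zero hf0 hg0) hs0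
  refine ⟨d, e, l, f, g, s, hf, hg, hs, hd, hd0, hh0, fun x hx hxh ↦ ?_⟩
  have hxm : x.asIdeal.IsMaximal := (PrimeSpectrum.isClosed_singleton_iff_isMaximal x).1 hx
  obtain ⟨ev, hev⟩ := exists_algHom_ker_eq x.asIdeal
  let y : Proj 𝒜 := coreProj hmm hm0 x.asIdeal hxh
  have hyc : IsClosed {y} := by
    rw [← closure_subset_iff_isClosed]
    intro z hz
    rw [mem_closure_proj_iff] at hz
    exact ProjectiveSpectrum.ext (asHomogeneousIdeal_eq_homogeneousCore_of_le hev hmm hm0 hxh z hz)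
  have hyh : f * g * s ∉ y.asHomogeneousIdeal :=
    fun h ↦ hxh (Ideal.toIdeal_homogeneousCore_le 𝒜 _ h)
  have hyU : y ∈ U := hsU fun h ↦ hyh (Ideal.mul_mem_left _ _ h)
  obtain ⟨C, ι, hC, hyC⟩ := H y hyU hyc
  obtain ⟨P, hP, hr⟩ := hC.exists_isRationalPoint
  rw [hr, mem_closure_proj_iff] at hyC
  exact ⟨P, ((isRationalPoint_proj_iff hmm hm0 P (fun h ↦ hyh (hyC h))).1 hP).imp fun ψ hψ ↦
    ⟨fun a ha ↦ Ideal.toIdeal_homogeneousCore_le 𝒜 _ (hyC ha), hψ⟩⟩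

theorem IsQuasirational.hasGeneralRationalCurves (H : IsQuasirational 𝒜) :
    HasGeneralRationalCurves 𝒜 := by
  obtain ⟨d, e, l, f, g, s, hf, hg, hs, hd, hd0, hh0, H⟩ := H.exists_chart
  have hne : ((PrimeSpectrum.basicOpen (f * g * s) : TopologicalSpace.Opens (PrimeSpectrum A)) :
      Set (PrimeSpectrum A)).Nonempty := ⟨⊥, hh0⟩
  refine ⟨PrimeSpectrum.basicOpen (f * g * s), hne,
    (PrimeSpectrum.basicOpen (f * g * s)).2.dense hne, fun x hxh hx ↦ ?_⟩
  obtain ⟨P, ψ, hPx, hψ, hker, hfrac⟩ := H x hx hxh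
  obtain ⟨Q, φ, hQx, hQ, hφ, hno⟩ := exists_rational_section hf hg hs hd hd0 x hx hxh
    P.asHomogeneousIdeal.toIdeal hPx ψ hψ hker hfrac
  obtain ⟨C, ι, hC, hr⟩ :=
    ((isRationalPoint_spec_iff Q).2 ⟨φ, hQ, hφ⟩).exists_isClosedRationalCurve
  refine ⟨C, ι, hC, ?_, fun ho ↦ hno ((iff_of_eq (congrArg (IsOrbitClosure 𝒜) hr)).1 ho)⟩
  rw [hr]
  exact (PrimeSpectrum.le_iff_mem_closure Q x).1 hQx

end

/-! ### Birational maps between affine varieties -/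

section

theorem isDominant_specMap_of_injective {R S : Type} [CommRing R] [CommRing S] (f : R →+* S)
    (hf : Function.Injective f) : IsDominant (Spec.map (CommRingCat.ofHom f)) := by
  refine ⟨?_⟩
  change DenseRange (PrimeSpectrum.comap f)
  rw [PrimeSpectrum.denseRange_comap_iff_ker_le_nilRadical,
    (RingHom.injective_iff_ker_eq_bot f).1 hf]
  exact bot_le

theorem birationalOver_of_isLocalization {R S : Type} [CommRing R] [IsDomain R] [CommRing S]
    [Algebra R S] [Algebra ℂ R] [Algebra ℂ S] [IsScalarTower ℂ R S]
    (r : R) (hr : r ≠ 0) [IsLocalization.Away r S] :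
    Scheme.BirationalOver (structureV S) (structureV R) := by
  have : IsOpenImmersion (Spec.map (CommRingCat.ofHom (algebraMap R S))) :=
    IsOpenImmersion.of_isLocalization r
  have : IsDominant (Spec.map (CommRingCat.ofHom (algebraMap R S))) :=
    isDominant_specMap_of_injective _
      (IsLocalization.injective S (powers_le_nonZeroDivisors_of_noZeroDivisors hr))
  refine Scheme.Hom.birationalOver (Spec.map (CommRingCat.ofHom (algebraMap R S))) _ _ ?_
  rw [structureV, structureV, ← Spec.map_comp, ← CommRingCat.ofHom_comp,
    ← IsScalarTower.algebraMap_eq]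

/-- A finitely generated extension of domains with the same field of fractions becomes an
isomorphism after localization at a common denominator of generators. -/
theorem birationalOver_of_injective {R S : Type} [CommRing R] [IsDomain R] [CommRing S] [IsDomain S]
    [Algebra ℂ R] [Algebra ℂ S] [Algebra.FiniteType ℂ S] (f : R →ₐ[ℂ] S)
    (hf : Function.Injective f) (hdiv : ∀ b : S, ∃ r₁ r₂, r₂ ≠ 0 ∧ b * f r₂ = f r₁) :
    Scheme.BirationalOver (structureV R) (structureV S) := by
  classical
  obtain ⟨T, hT⟩ := Algebra.FiniteType.out (R := ℂ) (A := S)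
  choose num den hden hnum using hdiv
  -- a common denominator of the generators of `S`
  let s : R := ∏ b ∈ T, den b
  have hs : s ≠ 0 := Finset.prod_ne_zero_iff.2 fun b _ ↦ hden b
  have hpow (b : S) : ∃ (k : ℕ) (a : R), b * f s ^ k = f a := by
    have hb : b ∈ Algebra.adjoin ℂ (T : Set S) := hT ▸ Algebra.mem_top
    induction hb using Algebra.adjoin_induction with
    | mem b hb =>
      obtain ⟨t, ht⟩ := Finset.dvd_prod_of_mem den (a := b) hb
      refine ⟨1, num b * t, ?_⟩
      rw [pow_one, map_mul, ← hnum, show s = den b * t from ht, map_mul]; ring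
    | algebraMap c => exact ⟨0, algebraMap ℂ R c, by simp⟩
    | add x y _ _ hx hy =>
      obtain ⟨k, a, h1⟩ := hx
      obtain ⟨l, b, h2⟩ := hy
      refine ⟨k + l, a * s ^ l + b * s ^ k, ?_⟩
      rw [map_add, map_mul, map_mul, map_pow, map_pow, ← h1, ← h2]; ring
    | mul x y _ _ hx hy =>
      obtain ⟨k, a, h1⟩ := hx
      obtain ⟨l, b, h2⟩ := hy
      refine ⟨k + l, a * b, ?_⟩
      rw [map_mul, ← h1, ← h2]; ring
  have hfs : f s ≠ 0 := by rwa [Ne, map_eq_zero_iff f hf]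
  let L := Localization.Away (f s)
  let := f.toRingHom.toAlgebra
  have : IsScalarTower ℂ R S := IsScalarTower.of_algebraMap_eq fun c ↦ (f.commutes c).symm
  have hRL (a : R) : algebraMap R L a = algebraMap S L (f a) :=
    IsScalarTower.algebraMap_apply R S L a
  have hST : IsScalarTower ℂ R L := inferInstance
  have hinj : Function.Injective (algebraMap S L) :=
    IsLocalization.injective L (powers_le_nonZeroDivisors_of_noZeroDivisors hfs)
  have hunit (n : ℕ) : IsUnit (algebraMap S L (f s ^ n)) := by
    rw [map_pow]
    exact (IsLocalization.Away.algebraMap_isUnit (S := L) (f s)).pow n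
  have hloc : IsLocalization.Away s L := by
    constructor
    constructor
    · rintro ⟨_, n, rfl⟩
      change IsUnit (algebraMap R L (s ^ n))
      rw [hRL, map_pow]
      exact hunit n
    · intro z
      obtain ⟨⟨b, _, l, rfl⟩, hz⟩ := IsLocalization.surj (Submonoid.powers (f s)) z
      obtain ⟨k, a, hk⟩ := hpow b
      refine ⟨⟨a, s ^ (l + k), l + k, rfl⟩, ?_⟩
      change z * algebraMap R L (s ^ (l + k)) = algebraMap R L a
      change z * algebraMap S L (f s ^ l) = algebraMap S L b at hz
      rw [hRL, hRL, ← hk, map_mul (algebraMap S L), ← hz, map_pow, pow_add, map_mul, mul_assoc]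
    · intro x y hxy
      rw [hRL, hRL] at hxy
      exact ⟨1, by rw [hf (hinj hxy)]⟩
  exact (birationalOver_of_isLocalization (S := L) s hs).symm.trans
    (birationalOver_of_isLocalization (S := L) (f s) hfs)

/-- Affine varieties with the same function field are birational: both are birational to the
spectrum of the subalgebra generated by the two coordinate rings. -/
theorem birationalOver_of_fractionField {R S K : Type} [CommRing R] [IsDomain R] [CommRing S]
    [IsDomain S] [Algebra ℂ R] [Algebra ℂ S] [Algebra.FiniteType ℂ R] [Algebra.FiniteType ℂ S]
    [Field K] [Algebra ℂ K] (φ : R →ₐ[ℂ] K) (ψ : S →ₐ[ℂ] K)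
    (hφ : Function.Injective φ) (hψ : Function.Injective ψ)
    (hφ' : ∀ b : K, ∃ r₁ r₂, φ r₂ ≠ 0 ∧ b * φ r₂ = φ r₁)
    (hψ' : ∀ b : K, ∃ r₁ r₂, ψ r₂ ≠ 0 ∧ b * ψ r₂ = ψ r₁) :
    Scheme.BirationalOver (structureV R) (structureV S) := by
  let B : Subalgebra ℂ K := φ.range ⊔ ψ.range
  have hB : Algebra.FiniteType ℂ B := by
    refine (Subalgebra.fg_iff_finiteType _).1 (Subalgebra.FG.sup ?_ ?_)
    · rw [← Algebra.map_top]; exact Subalgebra.FG.map _ Algebra.FiniteType.out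
    · rw [← Algebra.map_top]; exact Subalgebra.FG.map _ Algebra.FiniteType.out
  have h1 : Scheme.BirationalOver (structureV R) (structureV B) := by
    refine birationalOver_of_injective (φ.codRestrict B fun r ↦
      (le_sup_left : φ.range ≤ B) ⟨r, rfl⟩) (fun a b h ↦ hφ (Subtype.ext_iff.1 h)) fun b ↦ ?_
    obtain ⟨r₁, r₂, h2, h3⟩ := hφ' b
    exact ⟨r₁, r₂, fun h ↦ h2 (by rw [h, map_zero]), Subtype.ext h3⟩
  have h2 : Scheme.BirationalOver (structureV S) (structureV B) := by
    refine birationalOver_of_injective (ψ.codRestrict B fun r ↦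
      (le_sup_right : ψ.range ≤ B) ⟨r, rfl⟩) (fun a b h ↦ hψ (Subtype.ext_iff.1 h)) fun b ↦ ?_
    obtain ⟨r₁, r₂, h2, h3⟩ := hψ' b
    exact ⟨r₁, r₂, fun h ↦ h2 (by rw [h, map_zero]), Subtype.ext h3⟩
  exact h1.trans h2.symm

theorem birationalOver_affineSpace (n : Type) :
    Scheme.BirationalOver (structureV (MvPolynomial n ℂ)) (𝔸(n; Spec (.of ℂ)) ↘ Spec (.of ℂ)) :=
  Scheme.Hom.birationalOver (AffineSpace.SpecIso n (.of ℂ)).inv _ _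
    (AffineSpace.SpecIso_inv_over (.of ℂ))

/-- The embedding is the comorphism of the composition of the generic point of affine space with the
inverse of a birational map. -/
theorem exists_injective_of_isRationalOver {A : Type} [CommRing A] [IsDomain A] [Algebra ℂ A]
    (h : Scheme.IsRationalOver (structureV A)) :
    ∃ (n : Type) (θ : A →ₐ[ℂ] FractionRing (MvPolynomial n ℂ)), Function.Injective θ := by
  obtain ⟨n, h⟩ := h.exists_birationalOver_affineSpace
  obtain ⟨F, hF⟩ := h.trans (birationalOver_affineSpace n).symm
  refine ⟨n, ?_⟩
  let R := MvPolynomial n ℂ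
  let K := FractionRing R
  -- the generic point of affine space, which factors through every nonempty open subset
  let j : Spec (.of K) ⟶ Spec (.of R) := Spec.map (CommRingCat.ofHom (algebraMap R K))
  have : IsIntegral (Spec (.of R)) := inferInstance
  have : IsIntegral (Spec (.of A)) := inferInstance
  have hne : (F.target : Set (Spec (.of R))).Nonempty := F.dense_target.nonempty
  have hne' : (F.source : Set (Spec (.of A))).Nonempty := F.dense_source.nonempty
  have : Nonempty F.target := hne.to_subtype
  have : Nonempty F.source := hne'.to_subtype
  let w : Spec (.of K) := (⊥ : PrimeSpectrum K)
  have hj : j w = genericPoint (Spec (.of R)) := by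
    rw [genericPoint_eq_bot_of_affine]
    refine PrimeSpectrum.ext ?_
    change Ideal.comap (algebraMap R K) ⊥ = ⊥
    exact (RingHom.injective_iff_ker_eq_bot _).1 (IsFractionRing.injective R K)
  have hw (z : Spec (.of K)) : z = w := Subsingleton.elim (α := PrimeSpectrum K) _ _
  have hr : Set.range j ⊆ Set.range F.target.ι := by
    rintro _ ⟨z, rfl⟩
    rw [hw z, hj, ← genericPoint_eq_of_isOpenImmersion F.target.ι]
    exact ⟨_, rfl⟩
  let j' := IsOpenImmersion.lift F.target.ι j hr
  have hj' : j' ≫ F.target.ι = j := IsOpenImmersion.lift_fac _ _ _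
  have hj'w : j' w = genericPoint F.target := by
    apply F.target.ι.isOpenEmbedding.injective
    rw [genericPoint_eq_of_isOpenImmersion F.target.ι, ← hj, ← hj']
    rfl
  obtain ⟨θ, hθ⟩ := Spec.map_surjective (j' ≫ F.iso.inv ≫ F.source.ι)
  have hθw : Spec.map θ w = genericPoint (Spec (.of A)) := by
    rw [hθ, Scheme.Hom.comp_apply, Scheme.Hom.comp_apply, hj'w,
      genericPoint_eq_of_isOpenImmersion F.iso.inv, genericPoint_eq_of_isOpenImmersion]
  have hθc : θ.hom.comp (algebraMap ℂ A) = algebraMap ℂ K := by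
    have h1 : Spec.map θ ≫ structureV A = j ≫ structureV R := by
      rw [hθ, Category.assoc, Category.assoc, ← hF, Iso.inv_hom_id_assoc, reassoc_of% hj']
    rw [structureV, structureV, ← Spec.map_comp, ← Spec.map_comp] at h1
    have h2 := congrArg CommRingCat.Hom.hom (Spec.map_injective h1)
    exact h2.trans (IsScalarTower.algebraMap_eq ℂ R K).symm
  refine ⟨⟨θ.hom, fun c ↦ RingHom.congr_fun hθc c⟩, ?_⟩
  refine (RingHom.injective_iff_ker_eq_bot θ.hom).2 ?_
  rw [genericPoint_eq_bot_of_affine] at hθw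
  exact congrArg PrimeSpectrum.asIdeal hθw

end

/-! ### Restriction of rational functions to a line -/

section

/-- If `A` embeds into a field of rational functions and `b` does not divide `a` with constant
quotient, then restriction to a suitable line gives a homomorphism `A →ₐ[ℂ] ℂ(t)` with the same
property. The line joins a point `x`, at which a common denominator `q` and the numerator `G` of `b`
do not vanish, to a point `y` at which the quotient takes another value. -/
theorem exists_restriction_to_line {A : Type} [CommRing A] [Algebra ℂ A] [Algebra.FiniteType ℂ A]
    {n : Type} (θ : A →ₐ[ℂ] FractionRing (MvPolynomial n ℂ)) (hθ : Function.Injective θ) {a b : A}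
    (hb : b ≠ 0) (hab : ∀ c : ℂ, a ≠ algebraMap ℂ A c * b) :
    ∃ φ : A →ₐ[ℂ] RatFunc ℂ, φ b ≠ 0 ∧ ∀ c : ℂ, φ a ≠ algebraMap ℂ (RatFunc ℂ) c * φ b := by
  classical
  let R := MvPolynomial n ℂ
  let K := FractionRing R
  obtain ⟨T, hT⟩ := Algebra.FiniteType.out (R := ℂ) (A := A)
  obtain ⟨⟨q, hq⟩, hqT⟩ := IsLocalization.exist_integer_multiples_of_finset (nonZeroDivisors R)
    ((insert a (insert b T)).image θ)
  have hq0 : q ≠ 0 := nonZeroDivisors.ne_zero hq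
  have hnum (t : A) (ht : t ∈ insert a (insert b T)) :
      ∃ p : R, θ t * algebraMap R K q = algebraMap R K p := by
    obtain ⟨p, hp⟩ := hqT (θ t) (Finset.mem_image_of_mem _ ht)
    exact ⟨p, by rw [hp, mul_comm]; exact (Algebra.smul_def q (θ t)).symm⟩
  obtain ⟨F, hF⟩ := hnum a (by simp)
  obtain ⟨G, hG⟩ := hnum b (by simp)
  have hRK : Function.Injective (algebraMap R K) := IsFractionRing.injective R K
  have hqK : algebraMap R K q ≠ 0 := by rwa [Ne, map_eq_zero_iff _ hRK]
  have hG0 : G ≠ 0 := by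
    rintro rfl
    rw [map_zero, mul_eq_zero, map_eq_zero_iff _ hθ] at hG
    exact hG.elim hb hqK
  have hpoint {p : R} (hp : p ≠ 0) : ∃ x : n → ℂ, MvPolynomial.eval x p ≠ 0 := by
    by_contra! H
    exact hp (MvPolynomial.funext fun x ↦ by rw [H x, map_zero])
  obtain ⟨x, hx⟩ := hpoint (mul_ne_zero hq0 hG0)
  rw [map_mul, mul_ne_zero_iff] at hx
  -- the quotient `F / G` is not constant, so some point `y` has a value different from that at `x`
  have hT0 : F * MvPolynomial.C (MvPolynomial.eval x G) -
      MvPolynomial.C (MvPolynomial.eval x F) * G ≠ 0 := by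
    intro h
    let c := MvPolynomial.eval x F / MvPolynomial.eval x G
    have h1 : F = MvPolynomial.C c * G := by
      have h2 : (MvPolynomial.C (MvPolynomial.eval x G) : R) ≠ 0 := by
        rw [Ne, MvPolynomial.C_eq_zero]; exact hx.2
      refine mul_right_cancel₀ h2 ?_
      rw [sub_eq_zero.1 h, mul_right_comm, ← MvPolynomial.C_mul, div_mul_cancel₀ _ hx.2]
    refine hab c (hθ (mul_right_cancel₀ hqK ?_))
    rw [hF, map_mul, θ.commutes, mul_assoc, hG, h1, map_mul]
    rfl
  obtain ⟨y, hy⟩ := hpoint hT0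
  -- restriction to the line through `x` and `y`, with `x` at parameter `0` and `y` at `1`
  let l : R →ₐ[ℂ] Polynomial ℂ := MvPolynomial.aeval fun i ↦
    Polynomial.C (x i) + Polynomial.X * Polynomial.C (y i - x i)
  have hl0 (p : R) : (l p).eval 0 = MvPolynomial.eval x p := by
    have : (Polynomial.aeval (0 : ℂ)).comp l = MvPolynomial.aeval x :=
      MvPolynomial.algHom_ext fun i ↦ by simp [l]
    exact DFunLike.congr_fun this p
  have hl1 (p : R) : (l p).eval 1 = MvPolynomial.eval y p := by
    have : (Polynomial.aeval (1 : ℂ)).comp l = MvPolynomial.aeval y :=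
      MvPolynomial.algHom_ext fun i ↦ by simp [l]
    exact DFunLike.congr_fun this p
  let l' : R →ₐ[ℂ] RatFunc ℂ := (IsScalarTower.toAlgHom ℂ (Polynomial ℂ) (RatFunc ℂ)).comp l
  have hl' {p : R} (hp : MvPolynomial.eval x p ≠ 0) : l' p ≠ 0 := by
    intro h
    refine hp ?_
    have h1 : l p = 0 := RatFunc.algebraMap_injective ℂ (h.trans (map_zero _).symm)
    rw [← hl0, h1, Polynomial.eval_zero]
  -- rational functions whose denominator does not vanish identically on the line
  let M : Submonoid R := (nonZeroDivisors (RatFunc ℂ)).comap l'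
  have hM : M ≤ nonZeroDivisors R := fun p hp ↦ mem_nonZeroDivisors_of_ne_zero fun h ↦
    nonZeroDivisors.ne_zero (Submonoid.mem_comap.1 hp) (by rw [h, map_zero])
  let B := Localization.subalgebra.ofField K M hM
  let ψ : B →+* RatFunc ℂ := IsLocalization.lift (M := M) (g := (l' : R →+* RatFunc ℂ))
    fun p ↦ (isUnit_iff_ne_zero.2 (nonZeroDivisors.ne_zero (Submonoid.mem_comap.1 p.2)))
  have hψ (p : R) : ψ (algebraMap R B p) = l' p := IsLocalization.lift_eq _ p
  have hB : θ.range ≤ B.restrictScalars ℂ := by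
    rw [← Algebra.map_top, ← hT, AlgHom.map_adjoin, Algebra.adjoin_le_iff]
    rintro _ ⟨t, ht, rfl⟩
    obtain ⟨p, hp⟩ := hnum t (by simp [Finset.mem_coe.1 ht])
    refine ⟨p, q, mem_nonZeroDivisors_of_ne_zero (hl' hx.1), ?_⟩
    rw [← hp, mul_inv_cancel_right₀ hqK]
  let θ' : A →+* B := (θ : A →+* K).codRestrict B.toSubring fun t ↦ hB ⟨t, rfl⟩
  let φ : A →ₐ[ℂ] RatFunc ℂ := ⟨ψ.comp θ', fun c ↦ by
    have : θ' (algebraMap ℂ A c) = algebraMap R B (MvPolynomial.C c) :=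
      Subtype.ext (θ.commutes c)
    change ψ (θ' (algebraMap ℂ A c)) = _
    rw [this, hψ]
    exact l'.commutes c⟩
  have hφ {t : A} {p : R} (h : θ t * algebraMap R K q = algebraMap R K p) :
      φ t * l' q = l' p := by
    rw [← hψ, ← hψ]
    change ψ (θ' t) * _ = _
    rw [← map_mul ψ]
    exact congrArg ψ (Subtype.ext h)
  refine ⟨φ, fun h ↦ hl' hx.2 (by rw [← hφ hG, h, zero_mul]), fun c hc ↦ hy ?_⟩
  have h1 : l F = Polynomial.C c * l G := by
    refine RatFunc.algebraMap_injective ℂ ?_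
    change l' F = _
    rw [← hφ hF, hc, mul_assoc, hφ hG, map_mul]
    rfl
  have h2 := congrArg (Polynomial.eval 0) h1
  have h3 := congrArg (Polynomial.eval 1) h1
  rw [Polynomial.eval_mul, Polynomial.eval_C, hl0, hl0] at h2
  rw [Polynomial.eval_mul, Polynomial.eval_C, hl1, hl1] at h3
  rw [map_sub, map_mul, map_mul, MvPolynomial.eval_C, MvPolynomial.eval_C, h2, h3]
  ring

end

/-! ### Surfaces -/

section

theorem mem_of_mul_eq {k K : Type} [Field k] [Field K] [Algebra k K] (E : IntermediateField k K)
    {x y z : K} (hy0 : y ≠ 0) (hy : y ∈ E) (hz : z ∈ E) (h : x * y = z) : x ∈ E := by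
  rw [eq_div_of_mul_eq hy0 h]
  exact div_mem hz hy

/-- The field `F(T)` is generated by `T` and the constants. -/
theorem intermediateField_ratFunc_eq_top {k F : Type} [Field k] [Field F] [Algebra k F]
    (E : IntermediateField k (RatFunc F))
    (hX : algebraMap (Polynomial F) (RatFunc F) Polynomial.X ∈ E)
    (hC : ∀ r : F, algebraMap (Polynomial F) (RatFunc F) (Polynomial.C r) ∈ E) : E = ⊤ := by
  have hpoly (p : Polynomial F) : algebraMap (Polynomial F) (RatFunc F) p ∈ E := by
    induction p using Polynomial.induction_on' with
    | add p q hp hq => rw [map_add]; exact add_mem hp hq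
    | monomial n r =>
      rw [← Polynomial.C_mul_X_pow_eq_monomial, map_mul, map_pow]
      exact mul_mem (hC r) (pow_mem hX n)
  refine eq_top_iff.2 fun z _ ↦ ?_
  obtain ⟨p, q, -, rfl⟩ := IsFractionRing.div_surjective (Polynomial F) z
  exact div_mem (hpoly p) (hpoly q)

theorem mem_intermediateField_of_ratFunc {k F : Type} [Field k] [Field F] [Algebra k F]
    (E : IntermediateField k F) (i : RatFunc k →+* F)
    (hi : ∀ p, i (algebraMap (Polynomial k) (RatFunc k) p) ∈ E) (r : RatFunc k) : i r ∈ E := by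
  obtain ⟨p, q, -, rfl⟩ := IsFractionRing.div_surjective (Polynomial k) r
  rw [map_div₀]
  exact div_mem (hi p) (hi q)

variable {A : Type} [CommRing A] [Algebra ℂ A] {𝒜 : ℕ → Submodule ℂ A} [GradedAlgebra 𝒜]
  [Algebra.FiniteType ℂ A]

/-- If any two homogeneous elements of the same positive degree were proportional, then every
nonzero prime would be maximal. -/
theorem exists_not_proportional [IsDomain A] (hdim : ringKrullDim A = 2)
    (hmax : (HomogeneousIdeal.irrelevant 𝒜).toIdeal.IsMaximal) :
    ∃ m, 0 < m ∧ ∃ a ∈ 𝒜 m, ∃ b ∈ 𝒜 m, b ≠ 0 ∧ ∀ c : ℂ, a ≠ algebraMap ℂ A c * b := by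
  by_contra! H
  have hne : (HomogeneousIdeal.irrelevant 𝒜).toIdeal ≠ ⊥ := by
    intro h
    have : IsField A := Ring.isField_iff_maximal_bot.2 (h ▸ hmax)
    rw [ringKrullDim_eq_zero_of_isField this] at hdim
    norm_num at hdim
  obtain ⟨z, hz, hz0⟩ := Submodule.exists_mem_ne_zero_of_ne_bot hne
  obtain ⟨m, hm, h, hh, hh0⟩ : ∃ m, 0 < m ∧ ∃ h ∈ 𝒜 m, h ≠ 0 := by
    obtain ⟨i, hi⟩ := exists_homogeneous_component_ne_zero (𝒜 := 𝒜) hz0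
    refine ⟨i, Nat.pos_iff_ne_zero.2 ?_, _, SetLike.coe_mem _, hi⟩
    rintro rfl
    exact hi ((HomogeneousIdeal.mem_irrelevant_iff 𝒜 z).1 hz)
  have h1 : Ring.KrullDimLE 1 A := .mk₁' fun Q hQ0 hQ ↦ by
    refine isMaximal_of_lt (𝒜 := 𝒜) (h := h) (m := m) (bot_lt_iff_ne_bot.2 hQ0) hm fun n a ha ↦ ?_
    rcases Nat.eq_zero_or_pos n with rfl | hn
    · obtain ⟨c, rfl⟩ := exists_algebraMap_eq_of_mem_zero hmax ha
      exact ⟨c ^ m, by simp⟩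
    · obtain ⟨c, hc⟩ := H (m * n) (by positivity) (a ^ m) (SetLike.pow_mem_graded m ha) (h ^ n)
        (by rw [mul_comm]; exact SetLike.pow_mem_graded n hh) (pow_ne_zero n hh0)
      exact ⟨c, by rw [hc, sub_self]; exact zero_mem _⟩
  rw [Ring.krullDimLE_iff, hdim] at h1
  norm_num at h1

/-- The composition of the parametrization of `Spec A` with a suitable line shows that `Proj A` is a
rational curve. -/
theorem isQuasirational_of_isRationalOver [IsDomain A] (hdim : ringKrullDim A = 2)
    (hmax : (HomogeneousIdeal.irrelevant 𝒜).toIdeal.IsMaximal)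
    (h : Scheme.IsRationalOver (structureV A)) : IsQuasirational 𝒜 := by
  obtain ⟨n, θ, hθ⟩ := exists_injective_of_isRationalOver h
  obtain ⟨m, hm, a, ha, b, hb, hb0, hab⟩ := exists_not_proportional hdim hmax
  obtain ⟨φ, hφb, hφ⟩ := exists_restriction_to_line θ hθ hb0 hab
  have hker : (RingHom.ker φ).IsPrime := RingHom.ker_isPrime _
  have ha' : a ∈ 𝒜 (1 • m) := by rwa [one_smul]
  let P : Proj 𝒜 := coreProj hb hm (RingHom.ker φ) hφb
  have hP := isRationalPoint_of_algHom hb hm φ hφb ha' (by simpa using hφ) P rfl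
  -- `P` is the generic point of `Proj A`, so that the curve is all of `Proj A`
  have hP0 : P.asHomogeneousIdeal.toIdeal = ⊥ := by
    refine eq_bot_of_ringKrullDim_eq_two hb hm hdim hmax (awayLift φ hφb)
      (awayLift_awayConst φ hφb) _ P.isPrime (fun n g hg ↦ ?_)
      (fun h ↦ hφb (Ideal.toIdeal_homogeneousCore_le 𝒜 _ h)) (Away.mk 𝒜 hb 1 a ha') fun c hc ↦
        hφ c ?_
    · rw [← mul_left_inj' (pow_ne_zero n hφb), awayLift_mk, zero_mul, map_pow,
        pow_eq_zero_iff hm.ne']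
      exact (mem_homogeneousCore_iff_of_mem 𝒜 (RingHom.ker φ) hg).symm
    · rw [← hc, ← awayLift_mk hb φ hφb ha', pow_one]
  obtain ⟨C, ι, hC, hr⟩ := hP.exists_isClosedRationalCurve
  refine ⟨⊤, ⟨P, trivial⟩, dense_univ, fun y _ _ ↦ ⟨C, ι, hC, ?_⟩⟩
  rw [hr, mem_closure_proj_iff]
  intro z hz
  have : z ∈ P.asHomogeneousIdeal.toIdeal := hz
  rw [hP0] at this
  rw [(Submodule.mem_bot A).1 this]
  exact zero_mem _

/-- The curve `Proj A` is rational, so that dehomogenization embeds `A` into `ℂ(t)(T)`, and the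
image generates this field. -/
theorem IsQuasirational.isRationalOver [IsDomain A] (hdim : ringKrullDim A = 2)
    (hmax : (HomogeneousIdeal.irrelevant 𝒜).toIdeal.IsMaximal)
    (H : IsQuasirational 𝒜) : Scheme.IsRationalOver (structureV A) := by
  obtain ⟨d, e, l, f, g, s, hf, hg, hs, hd, hd0, hh0, H⟩ := H.exists_chart
  have hmm := mul_mul_mem hf hg hs
  have hm0 : 0 < e + d + e + l := by omega
  obtain ⟨x, hx, -, hxh⟩ := exists_isMaximal_ge_notMem (⊥ : Ideal A)
    (a := f * g * s) (by simpa using hh0)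
  obtain ⟨P, ψ, hPx, hψ, hker, hfrac⟩ := H ⟨x, hx.isPrime⟩
    ((PrimeSpectrum.isClosed_singleton_iff_isMaximal _).2 hx) hxh
  obtain ⟨α, hα⟩ := exists_apply_ne_algebraMap ψ hfrac
  have hP0 : P.asHomogeneousIdeal.toIdeal = ⊥ :=
    eq_bot_of_ringKrullDim_eq_two hmm hm0 hdim hmax ψ hψ _ P.isPrime hker
      (fun h ↦ hxh (hPx h)) α hα
  have hψinj : Function.Injective ψ := by
    refine (injective_iff_map_eq_zero ψ).2 fun β hβ ↦ ?_
    obtain ⟨k, a, ha, rfl⟩ := Away.mk_surjective 𝒜 hmm β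
    have h1 : a ∈ P.asHomogeneousIdeal.toIdeal := by
      refine (hker _ a ha).1 ?_
      rw [isLocalizationElem_eq_pow, map_pow, hβ, zero_pow hm0.ne']
    rw [hP0, Submodule.mem_bot] at h1
    subst h1
    apply val_injective
    apply (isUnit_algebraMap_pow _ k).mul_right_cancel
    rw [val_mk_mul]
    simp
  let F := RatFunc (RatFunc ℂ)
  let j : Polynomial (RatFunc ℂ) →+* F := algebraMap _ _
  have hj : Function.Injective j := RatFunc.algebraMap_injective _
  let Φ : A →ₐ[ℂ] F :=
    { (j.comp (Polynomial.mapRingHom ψ)).comp (dehomogenize hf hg hs hd) with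
      commutes' := fun c ↦ by
        change j (Polynomial.map ψ (dehomogenize hf hg hs hd (algebraMap ℂ A c))) = _
        rw [dehomogenize_algebraMap, Polynomial.map_C]
        change j (Polynomial.C (ψ.comp (awayConst 𝒜 (f * g * s)) c)) = _
        rw [hψ]
        rfl }
  have hΦ (a : A) : Φ a = j (Polynomial.map ψ (dehomogenize hf hg hs hd a)) := rfl
  have hΦinj : Function.Injective Φ := (hj.comp (Polynomial.map_injective ψ hψinj)).comp
    (dehomogenize_injective hf hg hs hd hh0)
  have hΦ0 {a : A} (ha : a ≠ 0) : Φ a ≠ 0 := by rwa [Ne, map_eq_zero_iff _ hΦinj]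
  -- the fractions of the image of `A` contain the variable `f / g` and the subfield `ℂ(t)`
  let E := fractionsOf (k := ℂ) (Φ : A →+* F) (algebraMap ℂ A) Φ.comp_algebraMap
  have hE : E = ⊤ := by
    refine intermediateField_ratFunc_eq_top E ⟨f, g, ?_, ?_⟩ fun r ↦ ?_
    · exact hΦ0 (by rintro rfl; exact hh0 (by ring))
    · change j Polynomial.X * Φ g = Φ f
      rw [hΦ f, dehomogenize_numerator hf hg hs hd hd0, Polynomial.map_mul, Polynomial.map_X,
        map_mul, ← hΦ]
    · have hmem (β : Away 𝒜 (f * g * s)) : j (Polynomial.C (ψ β)) ∈ E := by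
        obtain ⟨k, a, ha, rfl⟩ := Away.mk_surjective 𝒜 hmm β
        refine ⟨a, (f * g * s) ^ k, hΦ0 (pow_ne_zero k hh0), ?_⟩
        change _ * Φ ((f * g * s) ^ k) = Φ a
        rw [hΦ a, dehomogenize_mk hf hg hs hd hh0 ha, Polynomial.map_mul, Polynomial.map_C,
          map_mul, Polynomial.map_pow, map_pow, map_pow, hΦ]
      obtain ⟨a, b, hb, hr⟩ := hfrac r
      refine mem_of_mul_eq E ?_ (hmem b) (hmem a)
        (by rw [← hr, Polynomial.C_mul, map_mul] : j (Polynomial.C r) * _ = _)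
      rwa [Ne, map_eq_zero_iff _ hj, Polynomial.C_eq_zero]
  -- the coordinate ring of the affine plane, embedded into the same field
  let S := MvPolynomial (Option PUnit) ℂ
  let ι : Polynomial (Polynomial ℂ) →ₐ[ℂ] F :=
    (IsScalarTower.toAlgHom ℂ (Polynomial (RatFunc ℂ)) F).comp
      (Polynomial.mapAlgHom (IsScalarTower.toAlgHom ℂ (Polynomial ℂ) (RatFunc ℂ)))
  have hι (p : Polynomial (Polynomial ℂ)) :
      ι p = j (p.map (algebraMap (Polynomial ℂ) (RatFunc ℂ))) := rfl
  have hιinj : Function.Injective ι :=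
    hj.comp (Polynomial.map_injective _ (RatFunc.algebraMap_injective ℂ))
  let ε : S ≃ₐ[ℂ] Polynomial (Polynomial ℂ) := (MvPolynomial.optionEquivLeft ℂ PUnit).trans
    (Polynomial.mapAlgEquiv (MvPolynomial.uniqueAlgEquiv ℂ PUnit))
  let Ψ : S →ₐ[ℂ] F := ι.comp (ε : S →ₐ[ℂ] Polynomial (Polynomial ℂ))
  have hΨ (p : Polynomial (Polynomial ℂ)) : Ψ (ε.symm p) = ι p := congrArg ι (ε.apply_symm_apply p)
  have hΨinj : Function.Injective Ψ := hιinj.comp ε.injective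
  let E' := fractionsOf (k := ℂ) (Ψ : S →+* F) (algebraMap ℂ S) Ψ.comp_algebraMap
  have hmem' (p : Polynomial (Polynomial ℂ)) : ι p ∈ E' := by
    rw [← hΨ]; exact apply_mem_fractionsOf (χ := (Ψ : S →+* F)) _
  have hE' : E' = ⊤ := by
    refine intermediateField_ratFunc_eq_top E' ?_ fun r ↦ ?_
    · have := hmem' Polynomial.X
      rwa [hι, Polynomial.map_X] at this
    · refine mem_intermediateField_of_ratFunc E' (j.comp Polynomial.C) (fun p ↦ ?_) r
      have := hmem' (Polynomial.C p)
      rwa [hι, Polynomial.map_C] at this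
  have hfr {r : F} : r ∈ E := hE ▸ IntermediateField.mem_top
  have hfr' {r : F} : r ∈ E' := hE' ▸ IntermediateField.mem_top
  exact ⟨_, (birationalOver_of_fractionField Φ Ψ hΦinj hΨinj (fun _ ↦ hfr) fun _ ↦ hfr').trans
    (birationalOver_affineSpace _)⟩

end

end Quasihomogeneous

end

theorem mainTheorem12 (A : Type) [CommRing A] [IsDomain A] [Algebra ℂ A] [Algebra.FiniteType ℂ A]
    (𝒜 : ℕ → Submodule ℂ A) [GradedAlgebra 𝒜] (p : PrimeSpectrum A)
    (hvertex : PrimeSpectrum.zeroLocus (HomogeneousIdeal.irrelevant 𝒜 : Set A) = {p})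
    (hp : Quasihomogeneous.IsIsolatedNormalSingularity p) :
    (Quasihomogeneous.IsQuasirational 𝒜 ↔ Quasihomogeneous.HasGeneralRationalCurves 𝒜) ∧
    (ringKrullDim A = 2 →
      [Quasihomogeneous.IsQuasirational 𝒜,
        Quasihomogeneous.HasGeneralRationalCurves 𝒜,
        Scheme.IsRationalOver (Quasihomogeneous.structureV A)].TFAE) := by
  have hmax := Quasihomogeneous.isMaximal_irrelevant hvertex
  have hiff : Quasihomogeneous.IsQuasirational 𝒜 ↔ Quasihomogeneous.HasGeneralRationalCurves 𝒜 :=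
    ⟨Quasihomogeneous.IsQuasirational.hasGeneralRationalCurves,
      Quasihomogeneous.isQuasirational_of_hasGeneralRationalCurves hmax⟩
  refine ⟨hiff, fun hdim ↦ ?_⟩
  tfae_have 1 ↔ 2 := hiff
  tfae_have 1 → 3 := Quasihomogeneous.IsQuasirational.isRationalOver hdim hmax
  tfae_have 3 → 1 := Quasihomogeneous.isQuasirational_of_isRationalOver hdim hmax
  tfae_finish
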